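/- **Setting.** An almost para-hypercomplex structure on a smooth manifold $M$ is a triple $(J_1,J_2,J_3)$ of smooth endomorphism fields of $TM$ with $J_1^2=-J_2^2=-J_3^2=-\mathrm{Id}$ and $J_1J_2=-J_2J_1=J_3$; it is a para-hypercomplex structure if the Nijenhuis tensors of $J_1,J_2,J_3$ vanish. A pseudo-Riemannian metric $g$ on $M$ is compatible with it if $g(J_1X,J_1Y)=-g(J_2X,J_2Y)=-g(J_3X,J_3Y)=g(X,Y)$; then $(g,J_1,J_2,J_3)$ is called para-hyperhermitian, with fundamental forms $\Omega_i(X,Y)=g(J_iX,Y)$. Let $\varepsilon\in\{1,-1\}$. Let $N=(n_{ij})\in GL(2,\mathbb Z)$ with $\det N=\varepsilon$ have real eigenvalues $\alpha>1$ and $\varepsilon/\alpha$, with corresponding real eigenvectors $(a_1,a_2)$ and $(b_1,b_2)$. Let $p,q,r$ be integers, $r\neq0$, put $A=(b_1a_2-b_2a_1)/r$, and let $c=(c_1,c_2)^T\in\mathbb R^2$ be the solution of $\varepsilon c=Nc+(e_1,e_2)^T+A\,(p,q)^T$, where $e_i=\tfrac12n_{i1}(n_{i1}-1)a_1b_1+\tfrac12n_{i2}(n_{i2}-1)a_2b_2+n_{i1}n_{i2}b_1a_2$.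 Let $\mathbb H$ be the upper half-plane. The group generated by $$\phi_0(z,w)=(\alpha z,\varepsilon w),\quad \phi_i(z,w)=(z+a_i,\,w+b_iz+c_i)\ (i=1,2),\quad \phi_3(z,w)=(z,w+A)$$ acts freely and properly discontinuously on $\mathbb H\times\mathbb C$. The quotient complex surface is, for $\varepsilon=-1$, an Inoue surface of type $S^-$ and, for $\varepsilon=1$, an Inoue surface of type $S^+$ with parameter $t=0$. **Theorem.** Let $S^-$ be any Inoue surface of type $S^-$, given by $N,p,q,r,\alpha,a,b,c$. Then: (1) For suitable integers $p',q'$ the data $N^2,p',q',r,\alpha^2,a,b,c$ define an Inoue surface $S^+$ of type $S^+$ with $t=0$. The identity of $\mathbb H\times\mathbb C$ induces a holomorphic covering map $\kappa:S^+\to S^-$ that is locally biholomorphic, the map $(z,w)\mapsto(\alpha z,-w)$ induces a fixed point free holomorphic involution $\sigma$ of $S^+$, and the fibres of $\kappa$ are exactly the orbits $\{m,\sigma(m)\}$; that is, $S^-=S^+/\sigma$. (2) On $\mathbb H\times\mathbb C$ put $\theta_1=\frac{dz}{\operatorname{Im}z}$, $\theta_2=dw-\frac{\operatorname{Im}w}{\operatorname{Im}z}\,dz$,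 $\Omega=\theta_1\wedge\theta_2$ and $\Omega_1=\operatorname{Re}(\theta_1\wedge\overline{\theta_2})$. There is a para-hyperhermitian structure $(g,J_1,J_2,J_3)$ on $S^+$ whose $J_1$ is the complex structure of $S^+$ and whose fundamental forms pull back to $(\Omega_1,\operatorname{Re}\Omega,\operatorname{Im}\Omega)$ on $\mathbb H\times\mathbb C$. The involution $\sigma$ is an anti-isometry: $\sigma^*g=-g$. (3) The para-hypercomplex structure $(J_1,J_2,J_3)$ descends through $\kappa$ to a para-hypercomplex structure on $S^-$ whose first member is the complex structure of $S^-$, and this structure on $S^-$ admits no compatible metric. In particular, every Inoue surface of type $S^-$ carries a para-hypercomplex structure that admits no compatible metric. -/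

import Mathlib

open scoped Manifold ContDiff Topology

/-! ### Para-hypercomplex structures and compatible metrics on smooth manifolds -/

section ParaHypercomplex

variable {E : Type*} [NormedAddCommGroup E] [NormedSpace ℝ E]
  (M : Type*) [TopologicalSpace M] [ChartedSpace E M] [IsManifold 𝓘(ℝ, E) ∞ M]

/-- A field of endomorphisms of the tangent spaces (not yet assumed to be smooth). -/
abbrev EndoField : Type _ :=
  ∀ x : M, TangentSpace 𝓘(ℝ, E) x →L[ℝ] TangentSpace 𝓘(ℝ, E) x

variable {M}

/-- A field of endomorphisms is smooth: it is a smooth section of the bundle `End(TM)`. -/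
def EndoField.IsSmooth (J : EndoField (E := E) M) : Prop :=
  ContMDiff 𝓘(ℝ, E) (𝓘(ℝ, E).prod 𝓘(ℝ, E →L[ℝ] E)) ∞
    (fun x ↦ Bundle.TotalSpace.mk' (E →L[ℝ] E)
      (E := fun x : M ↦ TangentSpace 𝓘(ℝ, E) x →L[ℝ] TangentSpace 𝓘(ℝ, E) x) x (J x))

/-- The Nijenhuis tensor
`[JV, JW] - J[JV, W] - J[V, JW] + J²[V, W]`
evaluated on two vector fields at a point. -/
noncomputable def EndoField.nijenhuis (J : EndoField (E := E) M)
    (V W : ∀ x : M, TangentSpace 𝓘(ℝ, E) x) (x : M) : TangentSpace 𝓘(ℝ, E) x :=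
  VectorField.mlieBracket 𝓘(ℝ, E) (fun y ↦ J y (V y)) (fun y ↦ J y (W y)) x
    - J x (VectorField.mlieBracket 𝓘(ℝ, E) (fun y ↦ J y (V y)) W x)
    - J x (VectorField.mlieBracket 𝓘(ℝ, E) V (fun y ↦ J y (W y)) x)
    + J x (J x (VectorField.mlieBracket 𝓘(ℝ, E) V W x))

/-- Vanishing of the Nijenhuis tensor on all (locally defined) smooth vector fields. -/
def EndoField.IsIntegrable (J : EndoField (E := E) M) : Prop :=
  ∀ (x : M) (V W : ∀ y : M, TangentSpace 𝓘(ℝ, E) y),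
    ContMDiffAt 𝓘(ℝ, E) 𝓘(ℝ, E).tangent ∞
      (fun y ↦ (Bundle.TotalSpace.mk' E y (V y) : TangentBundle 𝓘(ℝ, E) M)) x →
    ContMDiffAt 𝓘(ℝ, E) 𝓘(ℝ, E).tangent ∞
      (fun y ↦ (Bundle.TotalSpace.mk' E y (W y) : TangentBundle 𝓘(ℝ, E) M)) x →
    J.nijenhuis V W x = 0

variable (M)

/-- A para-hypercomplex structure: three smooth integrable fields of endomorphisms with
`J₁² = -J₂² = -J₃² = -Id` and `J₁J₂ = -J₂J₁ = J₃`. -/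
structure ParaHypercomplex where
  J₁ : EndoField (E := E) M
  J₂ : EndoField (E := E) M
  J₃ : EndoField (E := E) M
  smooth₁ : J₁.IsSmooth
  smooth₂ : J₂.IsSmooth
  smooth₃ : J₃.IsSmooth
  sq₁ : ∀ x v, J₁ x (J₁ x v) = -v
  sq₂ : ∀ x v, J₂ x (J₂ x v) = v
  sq₃ : ∀ x v, J₃ x (J₃ x v) = v
  mul₁₂ : ∀ x v, J₁ x (J₂ x v) = J₃ x v
  mul₂₁ : ∀ x v, J₂ x (J₁ x v) = -J₃ x v
  integrable₁ : J₁.IsIntegrable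
  integrable₂ : J₂.IsIntegrable
  integrable₃ : J₃.IsIntegrable

/-- A pseudo-Riemannian metric of arbitrary signature: a smooth field of non-degenerate
symmetric bilinear forms on the tangent spaces. -/
structure PseudoRiemannianMetric where
  form : ∀ x : M, TangentSpace 𝓘(ℝ, E) x →L[ℝ] TangentSpace 𝓘(ℝ, E) x →L[ℝ] ℝ
  smooth : ContMDiff 𝓘(ℝ, E) (𝓘(ℝ, E).prod 𝓘(ℝ, E →L[ℝ] E →L[ℝ] ℝ)) ∞
    (fun x ↦ Bundle.TotalSpace.mk' (E →L[ℝ] E →L[ℝ] ℝ)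
      (E := fun x : M ↦ TangentSpace 𝓘(ℝ, E) x →L[ℝ] TangentSpace 𝓘(ℝ, E) x →L[ℝ] ℝ)
      x (form x))
  symm : ∀ x v w, form x v w = form x w v
  nondegenerate : ∀ x v, (∀ w, form x v w = 0) → v = 0

variable {M}

/-- `g(J₁v, J₁w) = -g(J₂v, J₂w) = -g(J₃v, J₃w) = g(v, w)`. -/
def PseudoRiemannianMetric.IsCompatible (g : PseudoRiemannianMetric (E := E) M)
    (P : ParaHypercomplex (E := E) M) : Prop :=
  ∀ x v w, g.form x (P.J₁ x v) (P.J₁ x w) = g.form x v w ∧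
    g.form x (P.J₂ x v) (P.J₂ x w) = -g.form x v w ∧
    g.form x (P.J₃ x v) (P.J₃ x w) = -g.form x v w

end ParaHypercomplex

/-! ### The covering space `ℍ × ℂ` and its affine transformations -/

namespace Inoue

/-- The product `ℍ × ℂ` of the upper half-plane and the complex plane, as an open subset of
`ℂ × ℂ`. -/
def HC : TopologicalSpace.Opens (ℂ × ℂ) :=
  ⟨{x | 0 < x.1.im}, isOpen_lt continuous_const (Complex.continuous_im.comp continuous_fst)⟩

/-- The transformation `(z, w) ↦ (s z + u, e w + β z + δ)` of `ℍ × ℂ`, where `s > 0`, `e = ±1`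
and `u`, `β`, `δ` are real. -/
noncomputable def aff (s : ℝ) (hs : 0 < s) (e : ℤˣ) (u β δ : ℝ) : Equiv.Perm HC where
  toFun x := ⟨(s * x.1.1 + u, ((e : ℤ) : ℂ) * x.1.2 + β * x.1.1 + δ), by
    have : 0 < x.1.1.im := x.2
    change 0 < Complex.im _
    simpa using mul_pos hs this⟩
  invFun x := ⟨(s⁻¹ * (x.1.1 - u), ((e : ℤ) : ℂ) * (x.1.2 - β * (s⁻¹ * (x.1.1 - u)) - δ)), by
    have : 0 < x.1.1.im := x.2
    change 0 < Complex.im _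
    have h := mul_pos (inv_pos.2 hs) this
    simpa using h⟩
  left_inv x := by
    have hs' : (s : ℂ) ≠ 0 := by exact_mod_cast hs.ne'
    apply Subtype.ext
    rcases Int.units_eq_one_or e with rfl | rfl <;> ext1 <;> simp <;> field_simp <;> ring
  right_inv x := by
    have hs' : (s : ℂ) ≠ 0 := by exact_mod_cast hs.ne'
    apply Subtype.ext
    rcases Int.units_eq_one_or e with rfl | rfl <;> ext1 <;> simp <;> field_simp <;> ring

theorem aff_val (s : ℝ) (hs : 0 < s) (e : ℤˣ) (u β δ : ℝ) (x : HC) :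
    (aff s hs e u β δ x).1 = (s * x.1.1 + u, ((e : ℤ) : ℂ) * x.1.2 + β * x.1.1 + δ) := rfl

theorem aff_mul (s s' : ℝ) (hs : 0 < s) (hs' : 0 < s') (e e' : ℤˣ) (u β δ u' β' δ' : ℝ) :
    aff s hs e u β δ * aff s' hs' e' u' β' δ' =
      aff (s * s') (mul_pos hs hs') (e * e') (s * u' + u) ((e : ℤ) * β' + β * s')
        ((e : ℤ) * δ' + β * u' + δ) := by
  ext1 x
  apply Subtype.ext
  rw [Equiv.Perm.mul_apply, aff_val, aff_val, aff_val]
  ext1 <;> push_cast <;> ring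

theorem aff_congr {s s' : ℝ} {hs : 0 < s} {hs' : 0 < s'} {e e' : ℤˣ} {u β δ u' β' δ' : ℝ}
    (h1 : s = s') (h2 : e = e') (h3 : u = u') (h4 : β = β') (h5 : δ = δ') :
    aff s hs e u β δ = aff s' hs' e' u' β' δ' := by
  subst h1 h2 h3 h4 h5; rfl

theorem aff_one : aff 1 one_pos 1 0 0 0 = 1 := by
  ext1 x
  apply Subtype.ext
  rw [aff_val]
  ext1 <;> simp

/-! ### The data and the groups defining the Inoue surfaces of type `S^±` -/

/-- The data defining an Inoue surface of type `S^+` with parameter `t = 0` (for `ε = 1`) or an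
Inoue surface of type `S^-` (for `ε = -1`): a matrix `N ∈ GL(2, ℤ)` with `det N = ε` and real
eigenvalues `α > 1` and `ε/α`, corresponding real eigenvectors `a` and `b`, integers `p`, `q`,
`r` with `r ≠ 0`, and the real solution `c` of the linear system
`ε c = N c + e + ((b₁a₂ - b₂a₁)/r) (p, q)`, where
`eᵢ = ½ nᵢ₁(nᵢ₁-1) a₁b₁ + ½ nᵢ₂(nᵢ₂-1) a₂b₂ + nᵢ₁nᵢ₂ b₁a₂`. The indices `1, 2` of the
mathematical notation are the indices `0, 1` of `Fin 2`. -/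
structure Data (ε : ℤˣ) where
  N : Matrix (Fin 2) (Fin 2) ℤ
  p : ℤ
  q : ℤ
  r : ℤ
  α : ℝ
  a : Fin 2 → ℝ
  b : Fin 2 → ℝ
  c : Fin 2 → ℝ
  r_ne_zero : r ≠ 0
  one_lt_α : 1 < α
  det_N : N.det = (ε : ℤ)
  a_ne_zero : a ≠ 0
  b_ne_zero : b ≠ 0
  N_mulVec_a : (N.map (Int.cast : ℤ → ℝ)).mulVec a = α • a
  N_mulVec_b : (N.map (Int.cast : ℤ → ℝ)).mulVec b = (((ε : ℤ) : ℝ) / α) • b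
  c_eq : ∀ i : Fin 2, ((ε : ℤ) : ℝ) * c i =
    (N i 0 * c 0 + N i 1 * c 1)
    + (1 / 2 * (N i 0 * (N i 0 - 1)) * a 0 * b 0 + 1 / 2 * (N i 1 * (N i 1 - 1)) * a 1 * b 1
        + N i 0 * N i 1 * b 0 * a 1)
    + (b 0 * a 1 - b 1 * a 0) / r * ((![p, q] i : ℤ) : ℝ)

namespace Data

variable {ε : ℤˣ} (D : Data ε)

/-- `A = (b₁a₂ - b₂a₁)/r`. -/
noncomputable def A : ℝ := (D.b 0 * D.a 1 - D.b 1 * D.a 0) / D.r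

theorem α_pos : 0 < D.α := one_pos.trans D.one_lt_α

/-- `φ₀(z, w) = (α z, ε w)`. -/
noncomputable def φ₀ : Equiv.Perm HC := aff D.α D.α_pos ε 0 0 0

/-- `φᵢ(z, w) = (z + aᵢ, w + bᵢ z + cᵢ)`, `i = 1, 2`. -/
noncomputable def φ (i : Fin 2) : Equiv.Perm HC := aff 1 one_pos 1 (D.a i) (D.b i) (D.c i)

/-- `φ₃(z, w) = (z, w + A)`. -/
noncomputable def φ₃ : Equiv.Perm HC := aff 1 one_pos 1 0 0 D.A

/-- The group of transformations of `ℍ × ℂ` generated by `φ₀, φ₁, φ₂, φ₃`. -/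
noncomputable def Γ : Subgroup (Equiv.Perm HC) :=
  Subgroup.closure {D.φ₀, D.φ 0, D.φ 1, D.φ₃}

/-! #### The group acts freely and properly discontinuously -/

theorem N_a (i : Fin 2) : D.N i 0 * D.a 0 + D.N i 1 * D.a 1 = D.α * D.a i := by
  have := congrFun D.N_mulVec_a i
  simpa [Matrix.mulVec, dotProduct, Fin.sum_univ_two] using this

theorem N_b (i : Fin 2) :
    D.N i 0 * D.b 0 + D.N i 1 * D.b 1 = ((ε : ℤ) : ℝ) / D.α * D.b i := by
  have := congrFun D.N_mulVec_b i
  simpa [Matrix.mulVec, dotProduct, Fin.sum_univ_two] using this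

theorem eps_sq : ((ε : ℤ) : ℝ) * ((ε : ℤ) : ℝ) = 1 := by
  rcases Int.units_eq_one_or ε with rfl | rfl <;> simp

/-- The eigenvectors `a` and `b` are linearly independent. -/
theorem det_ne_zero : D.b 0 * D.a 1 - D.b 1 * D.a 0 ≠ 0 := by
  intro h
  have hα := D.α_pos
  have h1 := D.one_lt_α
  have ea := D.N_a
  have eb := D.N_b
  have key : ∀ i, D.α * D.α * D.a i * D.b 0 = ((ε : ℤ) : ℝ) * D.b 0 * D.a i ∧
      D.α * D.α * D.a i * D.b 1 = ((ε : ℤ) : ℝ) * D.b 1 * D.a i := by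
    have e0 := ea 0
    have e1 := ea 1
    have f0 := eb 0
    have f1 := eb 1
    rw [div_mul_eq_mul_div, eq_div_iff hα.ne'] at f0 f1
    intro i
    fin_cases i
    · constructor
      · simp only [Fin.zero_eta, Fin.isValue]
        linear_combination (-D.α * D.b 0) * e0 + D.a 0 * f0 + (D.α * D.N 0 1) * h
      · simp only [Fin.zero_eta, Fin.isValue]
        linear_combination (-D.α * D.b 0) * e1 + D.a 0 * f1 + (D.α * D.N 1 1) * h
          - (D.α * D.α) * h
    · constructor
      · simp only [Fin.mk_one, Fin.isValue]
        linear_combination (-D.α * D.b 1) * e0 + D.a 1 * f0 - (D.α * D.N 0 0) * h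
          + (D.α * D.α) * h
      · simp only [Fin.mk_one, Fin.isValue]
        linear_combination (-D.α * D.b 1) * e1 + D.a 1 * f1 - (D.α * D.N 1 0) * h
  have hne : D.α * D.α - ((ε : ℤ) : ℝ) ≠ 0 := by
    rcases Int.units_eq_one_or ε with rfl | rfl <;> simp <;> nlinarith
  have z0 : ∀ i, D.a i * D.b 0 = 0 := fun i ↦ by
    have := (key i).1
    refine (mul_eq_zero.1 (?_ : (D.α * D.α - ((ε : ℤ) : ℝ)) * _ = 0)).resolve_left hne
    linear_combination this
  have z1 : ∀ i, D.a i * D.b 1 = 0 := fun i ↦ by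
    have := (key i).2
    refine (mul_eq_zero.1 (?_ : (D.α * D.α - ((ε : ℤ) : ℝ)) * _ = 0)).resolve_left hne
    linear_combination this
  apply D.a_ne_zero
  ext i
  by_contra hi
  apply D.b_ne_zero
  ext j
  fin_cases j
  · exact (mul_eq_zero.1 (z0 i)).resolve_left hi
  · exact (mul_eq_zero.1 (z1 i)).resolve_left hi

theorem A_ne_zero : D.A ≠ 0 :=
  div_ne_zero D.det_ne_zero (by exact_mod_cast D.r_ne_zero)

theorem r_mul_A : D.r * D.A = D.b 0 * D.a 1 - D.b 1 * D.a 0 :=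
  mul_div_cancel₀ _ (by exact_mod_cast D.r_ne_zero)

/-- The translation part of `φ₁ ^ m * φ₂ ^ n`. -/
noncomputable def h (m n : ℤ) : ℝ :=
  m * D.c 0 + n * D.c 1 + 1 / 2 * (m * (m - 1)) * D.a 0 * D.b 0
    + 1 / 2 * (n * (n - 1)) * D.a 1 * D.b 1 + m * n * D.b 0 * D.a 1

/-- The transformation `φ₁ ^ m * φ₂ ^ n * φ₃ ^ l * φ₀ ^ k`. -/
noncomputable def nf (m n l k : ℤ) : Equiv.Perm HC :=
  aff (D.α ^ k) (zpow_pos D.α_pos k) (ε ^ k) (m * D.a 0 + n * D.a 1)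
    ((m * D.b 0 + n * D.b 1) * D.α ^ k) (D.h m n + l * D.A)

theorem exists_h (m n : ℤ) : ∃ j : ℤ, ((ε : ℤ) : ℝ) * D.h m n =
    D.h (m * D.N 0 0 + n * D.N 1 0) (m * D.N 0 1 + n * D.N 1 1) + j * D.A := by
  have hα := D.α_pos
  have hr := D.r_mul_A
  have add : ∀ m n m' n' : ℤ,
      (∃ j : ℤ, ((ε : ℤ) : ℝ) * D.h m n =
        D.h (m * D.N 0 0 + n * D.N 1 0) (m * D.N 0 1 + n * D.N 1 1) + j * D.A) →
      (∃ j : ℤ, ((ε : ℤ) : ℝ) * D.h m' n' =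
        D.h (m' * D.N 0 0 + n' * D.N 1 0) (m' * D.N 0 1 + n' * D.N 1 1) + j * D.A) →
      ∃ j : ℤ, ((ε : ℤ) : ℝ) * D.h (m + m') (n + n') =
        D.h ((m + m') * D.N 0 0 + (n + n') * D.N 1 0)
          ((m + m') * D.N 0 1 + (n + n') * D.N 1 1) + j * D.A := by
    rintro m n m' n' ⟨j, hj⟩ ⟨j', hj'⟩
    have cocycle : ∀ m n m' n' : ℤ, D.h (m + m') (n + n') = D.h m n + D.h m' n'
        + (m * D.b 0 + n * D.b 1) * (m' * D.a 0 + n' * D.a 1) + D.r * D.A * n * m' := by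
      intro m n m' n'
      rw [hr]
      simp only [h]
      push_cast
      ring
    have e1 : (m + m') * D.N 0 0 + (n + n') * D.N 1 0 =
        (m * D.N 0 0 + n * D.N 1 0) + (m' * D.N 0 0 + n' * D.N 1 0) := by ring
    have e2 : (m + m') * D.N 0 1 + (n + n') * D.N 1 1 =
        (m * D.N 0 1 + n * D.N 1 1) + (m' * D.N 0 1 + n' * D.N 1 1) := by ring
    rw [e1, e2, cocycle, cocycle]
    have eb : ((m * D.N 0 0 + n * D.N 1 0 : ℤ) : ℝ) * D.b 0
        + ((m * D.N 0 1 + n * D.N 1 1 : ℤ) : ℝ) * D.b 1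
        = ((ε : ℤ) : ℝ) / D.α * (m * D.b 0 + n * D.b 1) := by
      push_cast
      linear_combination m * D.N_b 0 + n * D.N_b 1
    have ea : ((m' * D.N 0 0 + n' * D.N 1 0 : ℤ) : ℝ) * D.a 0
        + ((m' * D.N 0 1 + n' * D.N 1 1 : ℤ) : ℝ) * D.a 1
        = D.α * (m' * D.a 0 + n' * D.a 1) := by
      push_cast
      linear_combination m' * D.N_a 0 + n' * D.N_a 1
    rw [eb, ea]
    refine ⟨j + j' + (ε : ℤ) * D.r * n * m'
      - D.r * (m * D.N 0 1 + n * D.N 1 1) * (m' * D.N 0 0 + n' * D.N 1 0), ?_⟩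
    have : ((ε : ℤ) : ℝ) / D.α * (m * D.b 0 + n * D.b 1) * (D.α * (m' * D.a 0 + n' * D.a 1))
        = ((ε : ℤ) : ℝ) * ((m * D.b 0 + n * D.b 1) * (m' * D.a 0 + n' * D.a 1)) := by
      field_simp
    rw [this]
    push_cast
    linear_combination hj + hj'
  have neg : ∀ m n : ℤ,
      (∃ j : ℤ, ((ε : ℤ) : ℝ) * D.h m n =
        D.h (m * D.N 0 0 + n * D.N 1 0) (m * D.N 0 1 + n * D.N 1 1) + j * D.A) →
      ∃ j : ℤ, ((ε : ℤ) : ℝ) * D.h (-m) (-n) =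
        D.h (-m * D.N 0 0 + -n * D.N 1 0) (-m * D.N 0 1 + -n * D.N 1 1) + j * D.A := by
    rintro m n ⟨j, hj⟩
    have cocycle : ∀ m n : ℤ, D.h (-m) (-n) = - D.h m n
        + (m * D.b 0 + n * D.b 1) * (m * D.a 0 + n * D.a 1) + D.r * D.A * n * m := by
      intro m n
      rw [hr]
      simp only [h]
      push_cast
      ring
    have e1 : -m * D.N 0 0 + -n * D.N 1 0 = -(m * D.N 0 0 + n * D.N 1 0) := by ring
    have e2 : -m * D.N 0 1 + -n * D.N 1 1 = -(m * D.N 0 1 + n * D.N 1 1) := by ring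
    rw [e1, e2, cocycle, cocycle]
    have eb : ((m * D.N 0 0 + n * D.N 1 0 : ℤ) : ℝ) * D.b 0
        + ((m * D.N 0 1 + n * D.N 1 1 : ℤ) : ℝ) * D.b 1
        = ((ε : ℤ) : ℝ) / D.α * (m * D.b 0 + n * D.b 1) := by
      push_cast
      linear_combination m * D.N_b 0 + n * D.N_b 1
    have ea : ((m * D.N 0 0 + n * D.N 1 0 : ℤ) : ℝ) * D.a 0
        + ((m * D.N 0 1 + n * D.N 1 1 : ℤ) : ℝ) * D.a 1
        = D.α * (m * D.a 0 + n * D.a 1) := by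
      push_cast
      linear_combination m * D.N_a 0 + n * D.N_a 1
    rw [eb, ea]
    refine ⟨-j + (ε : ℤ) * D.r * n * m
      - D.r * (m * D.N 0 1 + n * D.N 1 1) * (m * D.N 0 0 + n * D.N 1 0), ?_⟩
    have : ((ε : ℤ) : ℝ) / D.α * (m * D.b 0 + n * D.b 1) * (D.α * (m * D.a 0 + n * D.a 1))
        = ((ε : ℤ) : ℝ) * ((m * D.b 0 + n * D.b 1) * (m * D.a 0 + n * D.a 1)) := by
      field_simp
    rw [this]
    push_cast
    linear_combination -hj
  have one : ∃ j : ℤ, ((ε : ℤ) : ℝ) * D.h 1 0 =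
        D.h (1 * D.N 0 0 + 0 * D.N 1 0) (1 * D.N 0 1 + 0 * D.N 1 1) + j * D.A := by
    refine ⟨D.p, ?_⟩
    have := D.c_eq 0
    simp only [h, A]
    simp at this ⊢
    linear_combination this
  have two : ∃ j : ℤ, ((ε : ℤ) : ℝ) * D.h 0 1 =
        D.h (0 * D.N 0 0 + 1 * D.N 1 0) (0 * D.N 0 1 + 1 * D.N 1 1) + j * D.A := by
    refine ⟨D.q, ?_⟩
    have := D.c_eq 1
    simp only [h, A]
    simp at this ⊢
    linear_combination this
  have zero : ∃ j : ℤ, ((ε : ℤ) : ℝ) * D.h 0 0 =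
        D.h (0 * D.N 0 0 + 0 * D.N 1 0) (0 * D.N 0 1 + 0 * D.N 1 1) + j * D.A :=
    ⟨0, by simp [h]⟩
  have left : ∀ m : ℤ, ∃ j : ℤ, ((ε : ℤ) : ℝ) * D.h m 0 =
        D.h (m * D.N 0 0 + 0 * D.N 1 0) (m * D.N 0 1 + 0 * D.N 1 1) + j * D.A := by
    intro m
    induction m using Int.induction_on with
    | zero => exact zero
    | succ i ih => simpa using add _ _ _ _ ih one
    | pred i ih => simpa [sub_eq_add_neg] using add _ _ _ _ ih (neg _ _ one)
  have right : ∀ n : ℤ, ∃ j : ℤ, ((ε : ℤ) : ℝ) * D.h 0 n =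
        D.h (0 * D.N 0 0 + n * D.N 1 0) (0 * D.N 0 1 + n * D.N 1 1) + j * D.A := by
    intro n
    induction n using Int.induction_on with
    | zero => exact zero
    | succ i ih => simpa using add _ _ _ _ ih two
    | pred i ih => simpa [sub_eq_add_neg] using add _ _ _ _ ih (neg _ _ two)
  simpa using add _ _ _ _ (left m) (right n)

/-- Every element of the group has the form `φ₁ ^ m * φ₂ ^ n * φ₃ ^ l * φ₀ ^ k`. -/
theorem exists_nf {γ : Equiv.Perm HC} (hγ : γ ∈ D.Γ) : ∃ m n l k : ℤ, γ = D.nf m n l k := by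
  have hr := D.r_mul_A
  have hα := D.α_pos
  induction hγ using Subgroup.closure_induction_left with
  | one =>
    refine ⟨0, 0, 0, 0, ?_⟩
    rw [← aff_one]
    apply aff_congr <;> simp [h]
  | mul_left x hx y hy ih =>
    obtain ⟨m, n, l, k, rfl⟩ := ih
    rcases hx with rfl | rfl | rfl | rfl
    · obtain ⟨j, hj⟩ := D.exists_h m n
      refine ⟨m * D.N 0 0 + n * D.N 1 0, m * D.N 0 1 + n * D.N 1 1, j + (ε : ℤ) * l, k + 1, ?_⟩
      rw [φ₀, nf, nf, aff_mul]
      apply aff_congr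
      · rw [zpow_add_one₀ hα.ne', mul_comm]
      · rw [zpow_add_one, mul_comm]
      · push_cast
        linear_combination -m * D.N_a 0 - n * D.N_a 1
      · push_cast
        have e : ((m : ℝ) * D.N 0 0 + n * D.N 1 0) * D.b 0 + (m * D.N 0 1 + n * D.N 1 1) * D.b 1
            = ((ε : ℤ) : ℝ) / D.α * (m * D.b 0 + n * D.b 1) := by
          linear_combination m * D.N_b 0 + n * D.N_b 1
        rw [e, zpow_add_one₀ hα.ne']
        field_simp
        ring
      · push_cast
        linear_combination hj
    · refine ⟨m + 1, n, l, k, ?_⟩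
      rw [φ, nf, nf, aff_mul]
      apply aff_congr <;> simp [h] <;> ring
    · refine ⟨m, n + 1, l - D.r * m, k, ?_⟩
      rw [φ, nf, nf, aff_mul]
      apply aff_congr
      · simp
      · simp
      · push_cast; ring
      · simp; ring
      · simp [h]
        linear_combination m * hr
    · refine ⟨m, n, l + 1, k, ?_⟩
      rw [φ₃, nf, nf, aff_mul]
      apply aff_congr <;> simp <;> ring
  | inv_mul_cancel x hx y hy ih =>
    obtain ⟨m, n, l, k, rfl⟩ := ih
    rcases hx with rfl | rfl | rfl | rfl
    · have hd := D.det_N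
      rw [Matrix.det_fin_two] at hd
      have hee : (ε : ℤ) * (ε : ℤ) = 1 := by
        rcases Int.units_eq_one_or ε with rfl | rfl <;> simp
      obtain ⟨m', n', rfl, rfl⟩ : ∃ m' n' : ℤ, m = m' * D.N 0 0 + n' * D.N 1 0 ∧
          n = m' * D.N 0 1 + n' * D.N 1 1 := by
        refine ⟨(ε : ℤ) * (m * D.N 1 1 - n * D.N 1 0),
          (ε : ℤ) * (n * D.N 0 0 - m * D.N 0 1), ?_, ?_⟩
        · linear_combination -m * hee - (ε : ℤ) * m * hd
        · linear_combination -n * hee - (ε : ℤ) * n * hd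
      obtain ⟨j, hj⟩ := D.exists_h m' n'
      refine ⟨m', n', (ε : ℤ) * (l - j), k - 1, ?_⟩
      rw [inv_mul_eq_iff_eq_mul, φ₀, nf, nf, aff_mul]
      apply aff_congr
      · rw [zpow_sub_one₀ hα.ne']
        field_simp
      · rw [zpow_sub_one, mul_left_comm, mul_inv_cancel, mul_one]
      · push_cast
        linear_combination m' * D.N_a 0 + n' * D.N_a 1
      · push_cast
        have e : ((m' : ℝ) * D.N 0 0 + n' * D.N 1 0) * D.b 0
            + (m' * D.N 0 1 + n' * D.N 1 1) * D.b 1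
            = ((ε : ℤ) : ℝ) / D.α * (m' * D.b 0 + n' * D.b 1) := by
          linear_combination m' * D.N_b 0 + n' * D.N_b 1
        rw [e, zpow_sub_one₀ hα.ne']
        field_simp
        ring
      · push_cast
        linear_combination -hj - (l - j) * D.A * (eps_sq (ε := ε))
    · refine ⟨m - 1, n, l, k, ?_⟩
      rw [inv_mul_eq_iff_eq_mul, φ, nf, nf, aff_mul]
      apply aff_congr <;> simp [h] <;> ring
    · refine ⟨m, n - 1, l + D.r * m, k, ?_⟩
      rw [inv_mul_eq_iff_eq_mul, φ, nf, nf, aff_mul]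
      apply aff_congr
      · simp
      · simp
      · push_cast; ring
      · simp; ring
      · simp [h]
        linear_combination -m * hr
    · refine ⟨m, n, l - 1, k, ?_⟩
      rw [inv_mul_eq_iff_eq_mul, φ₃, nf, nf, aff_mul]
      apply aff_congr <;> simp <;> ring

theorem continuous_aff (s : ℝ) (hs : 0 < s) (e : ℤˣ) (u β δ : ℝ) :
    Continuous (aff s hs e u β δ) := by
  refine Continuous.subtype_mk ?_ _
  fun_prop

instance : ContinuousConstSMul D.Γ HC where
  continuous_const_smul γ := by
    obtain ⟨m, n, l, k, h⟩ := D.exists_nf γ.2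
    change Continuous (γ : Equiv.Perm HC)
    rw [h]
    exact continuous_aff _ _ _ _ _ _

set_option maxHeartbeats 1000000 in
theorem exists_nhds_disjoint (x : HC) :
    ∃ U ∈ 𝓝 x, ∀ γ : D.Γ, ((γ • ·) '' U ∩ U).Nonempty → γ = 1 := by
  have hα := D.α_pos
  have h1 := D.one_lt_α
  have hx : 0 < x.1.1.im := x.2
  set y := x.1.1.im with hy
  set d := D.b 0 * D.a 1 - D.b 1 * D.a 0 with hd
  have hd0 : 0 < |d| := abs_pos.2 D.det_ne_zero
  have hA0 : 0 < |D.A| := abs_pos.2 D.A_ne_zero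
  set C := |D.a 0| + |D.a 1| + |D.b 0| + |D.b 1| + 1 with hC
  have hC0 : 0 < C := by positivity
  -- bounds on the real number `t` measuring the size of the neighbourhood
  obtain ⟨t, ht0, ht1, ht2, ht3, ht4⟩ : ∃ t : ℝ, 0 < t ∧ t < y / 2 ∧ (1 + D.α) * t < (D.α - 1) * y
      ∧ 2 * t * C * (1 + 2 / y) < |d| ∧ 2 * t < |D.A| := by
    have e1 : 0 < y / 2 := by positivity
    have e2 : 0 < (D.α - 1) * y / (1 + D.α) := by
      have : 0 < D.α - 1 := by linarith
      positivity
    have e3 : 0 < |d| / (2 * C * (1 + 2 / y)) := by positivity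
    have e4 : 0 < |D.A| / 2 := by positivity
    obtain ⟨t, ht0, ht⟩ := exists_between (lt_min (lt_min e1 e2) (lt_min e3 e4))
    simp only [lt_min_iff] at ht
    refine ⟨t, ht0, ht.1.1, ?_, ?_, by linarith [ht.2.2]⟩
    · have := (lt_div_iff₀ (by positivity)).1 ht.1.2
      linarith
    · have := (lt_div_iff₀ (by positivity)).1 ht.2.1
      linarith
  refine ⟨Metric.ball x t, Metric.ball_mem_nhds x ht0, ?_⟩
  rintro γ ⟨v', ⟨v, hv, rfl⟩, hv'⟩
  obtain ⟨m, n, l, k, h⟩ := D.exists_nf γ.2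
  have hsm : (γ • v : HC) = D.nf m n l k v := by
    rw [← h]; rfl
  simp only [hsm] at hv'
  have dist_bounds : ∀ v ∈ Metric.ball x t, ‖v.1.1 - x.1.1‖ < t ∧ ‖v.1.2 - x.1.2‖ < t := by
    intro v hv
    have : dist v.1 x.1 < t := hv
    rw [Prod.dist_eq, max_lt_iff, dist_eq_norm, dist_eq_norm] at this
    exact this
  obtain ⟨hv1, hv2⟩ := dist_bounds v hv
  obtain ⟨hw1, hw2⟩ := dist_bounds _ hv'
  set w := D.nf m n l k v with hw
  have im1 : |v.1.1.im - y| < t := lt_of_le_of_lt (Complex.abs_im_le_norm (v.1.1 - x.1.1)) hv1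
  have im2 : |w.1.1.im - y| < t := lt_of_le_of_lt (Complex.abs_im_le_norm (w.1.1 - x.1.1)) hw1
  rw [abs_lt] at im1 im2
  have wim : w.1.1.im = D.α ^ k * v.1.1.im := by
    rw [hw, nf, aff_val]
    simp only [Complex.add_im, Complex.im_ofReal_mul, Complex.ofReal_im, add_zero]
  have hk : k = 0 := by
    by_contra hk
    rcases lt_or_gt_of_ne hk with hk | hk
    · have e : D.α ^ k ≤ D.α ^ (-1 : ℤ) := zpow_le_zpow_right₀ h1.le (by omega)
      rw [zpow_neg_one] at e
      have : w.1.1.im ≤ D.α⁻¹ * v.1.1.im := by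
        rw [wim]
        exact mul_le_mul_of_nonneg_right e (by linarith)
      have : D.α * w.1.1.im ≤ v.1.1.im := by
        calc D.α * w.1.1.im ≤ D.α * (D.α⁻¹ * v.1.1.im) := mul_le_mul_of_nonneg_left this hα.le
          _ = v.1.1.im := by field_simp
      nlinarith
    · have e : D.α ^ (1 : ℤ) ≤ D.α ^ k := zpow_le_zpow_right₀ h1.le (by omega)
      rw [zpow_one] at e
      have : D.α * v.1.1.im ≤ w.1.1.im := by
        rw [wim]
        exact mul_le_mul_of_nonneg_right e (by linarith)
      nlinarith
  subst hk
  have w1 : w.1.1 = v.1.1 + ((m * D.a 0 + n * D.a 1 : ℝ) : ℂ) := by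
    rw [hw, nf, aff_val]; simp
  have w2 : w.1.2 = v.1.2 + ((m * D.b 0 + n * D.b 1 : ℝ) : ℂ) * v.1.1
      + ((D.h m n + l * D.A : ℝ) : ℂ) := by
    rw [hw, nf, aff_val]; simp
  have ba : |m * D.a 0 + n * D.a 1| < 2 * t := by
    have : ((m * D.a 0 + n * D.a 1 : ℝ) : ℂ) = (w.1.1 - x.1.1) - (v.1.1 - x.1.1) := by
      rw [w1]; ring
    rw [← Real.norm_eq_abs, ← Complex.norm_real, this]
    linarith [norm_sub_le (w.1.1 - x.1.1) (v.1.1 - x.1.1)]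
  have bw : ‖w.1.2 - v.1.2‖ < 2 * t := by
    have : w.1.2 - v.1.2 = (w.1.2 - x.1.2) - (v.1.2 - x.1.2) := by ring
    rw [this]
    linarith [norm_sub_le (w.1.2 - x.1.2) (v.1.2 - x.1.2)]
  have bb : |m * D.b 0 + n * D.b 1| < 2 * t * (2 / y) := by
    have e : (w.1.2 - v.1.2).im = (m * D.b 0 + n * D.b 1) * v.1.1.im := by
      rw [w2]
      simp only [Complex.sub_im, Complex.add_im, Complex.im_ofReal_mul,
        Complex.ofReal_im]
      ring
    have e' := lt_of_le_of_lt (Complex.abs_im_le_norm (w.1.2 - v.1.2)) bw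
    have hv0 : y / 2 < v.1.1.im := by linarith
    rw [e, abs_mul, abs_of_pos (lt_trans (by positivity) hv0)] at e'
    rw [mul_div_assoc', lt_div_iff₀ hx]
    nlinarith [abs_nonneg (m * D.b 0 + n * D.b 1)]
  have int_zero : ∀ j : ℤ, |j * d| < |d| → j = 0 := by
    intro j hj
    rw [abs_mul] at hj
    have : |(j : ℝ)| < 1 := by
      by_contra hc
      nlinarith
    rw [← Int.cast_abs] at this
    have : |j| < 1 := by exact_mod_cast this
    exact Int.abs_lt_one_iff.1 this
  have bound : ∀ s s' : ℝ, |s| ≤ C → |s'| ≤ C →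
      |s * (m * D.a 0 + n * D.a 1) + s' * (m * D.b 0 + n * D.b 1)| < |d| := by
    intro s s' hs hs'
    calc _ ≤ |s * (m * D.a 0 + n * D.a 1)| + |s' * (m * D.b 0 + n * D.b 1)| := abs_add_le _ _
      _ ≤ C * (2 * t) + C * (2 * t * (2 / y)) := by
        rw [abs_mul, abs_mul]
        gcongr
      _ = 2 * t * C * (1 + 2 / y) := by ring
      _ < |d| := ht3
  have hm : m = 0 := by
    apply int_zero
    have : m * d = -D.b 1 * (m * D.a 0 + n * D.a 1) + D.a 1 * (m * D.b 0 + n * D.b 1) := by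
      rw [hd]; ring
    rw [this]
    apply bound
    · rw [abs_neg, hC]
      linarith [abs_nonneg (D.a 0), abs_nonneg (D.a 1), abs_nonneg (D.b 0), abs_nonneg (D.b 1)]
    · rw [hC]
      linarith [abs_nonneg (D.a 0), abs_nonneg (D.a 1), abs_nonneg (D.b 0), abs_nonneg (D.b 1)]
  have hn : n = 0 := by
    apply int_zero
    have : n * d = D.b 0 * (m * D.a 0 + n * D.a 1) + -D.a 0 * (m * D.b 0 + n * D.b 1) := by
      rw [hd]; ring
    rw [this]
    apply bound
    · rw [hC]
      linarith [abs_nonneg (D.a 0), abs_nonneg (D.a 1), abs_nonneg (D.b 0), abs_nonneg (D.b 1)]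
    · rw [abs_neg, hC]
      linarith [abs_nonneg (D.a 0), abs_nonneg (D.a 1), abs_nonneg (D.b 0), abs_nonneg (D.b 1)]
  subst hm hn
  have hl : l = 0 := by
    have e : w.1.2 - v.1.2 = ((l * D.A : ℝ) : ℂ) := by
      rw [w2]; simp [Data.h]
    rw [e, Complex.norm_real, Real.norm_eq_abs, abs_mul] at bw
    have : |(l : ℝ)| < 1 := by
      by_contra hc
      nlinarith
    rw [← Int.cast_abs] at this
    have : |l| < 1 := by exact_mod_cast this
    exact Int.abs_lt_one_iff.1 this
  subst hl
  apply Subtype.ext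
  rw [h, Subgroup.coe_one, ← aff_one]
  apply aff_congr <;> simp [Data.h]

/-! ### The surfaces -/

/-- The Inoue surface: the quotient of `ℍ × ℂ` by the action of the group. -/
def Surface : Type := MulAction.orbitRel.Quotient D.Γ HC

instance : TopologicalSpace D.Surface :=
  inferInstanceAs (TopologicalSpace (MulAction.orbitRel.Quotient D.Γ HC))

/-- The projection `ℍ × ℂ → S`. -/
noncomputable def proj (x : HC) : D.Surface := Quotient.mk (MulAction.orbitRel D.Γ HC) x

theorem isQuotientCoveringMap_proj : IsQuotientCoveringMap D.proj D.Γ where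
  __ := (isQuotientMap_quotient_mk' : Topology.IsQuotientMap (Quotient.mk (MulAction.orbitRel D.Γ HC)))
  apply_eq_iff_mem_orbit := Quotient.eq''
  disjoint := D.exists_nhds_disjoint

theorem isLocalHomeomorph_proj : IsLocalHomeomorph D.proj :=
  D.isQuotientCoveringMap_proj.isCoveringMap.isLocalHomeomorph

theorem surjective_proj : Function.Surjective D.proj := D.isQuotientCoveringMap_proj.surjective

/-- The charts of the surface are the local inverses of the projection from `ℍ × ℂ ⊆ ℂ × ℂ`. -/
noncomputable instance : ChartedSpace (ℂ × ℂ) D.Surface :=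
  D.isLocalHomeomorph_proj.chartedSpace D.surjective_proj

theorem isManifold (𝕜 : Type) [NontriviallyNormedField 𝕜] [NormedAlgebra 𝕜 ℂ] (n : ℕ∞ω) :
    IsManifold 𝓘(𝕜, ℂ × ℂ) n D.Surface := by
  apply isManifold_of_contDiffOn
  rintro e e' ⟨q, rfl⟩ ⟨q', rfl⟩
  set L := D.isLocalHomeomorph_proj.localInverseAt (D.surjective_proj.hasRightInverse.choose q)
    with hL
  set L' := D.isLocalHomeomorph_proj.localInverseAt (D.surjective_proj.hasRightInverse.choose q')
    with hL'
  have hLs : ∀ x, L.symm x = D.proj x := fun x ↦ by rw [hL, IsLocalHomeomorph.localInverseAt_symm]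
  have hLs' : ∀ x, L'.symm x = D.proj x := fun x ↦ by
    rw [hL', IsLocalHomeomorph.localInverseAt_symm]
  have hc : ∀ x y : HC, chartAt (ℂ × ℂ) x y = y.1 := fun x y ↦ rfl
  have hcs : ∀ x y : HC, (chartAt (ℂ × ℂ) x).symm y.1 = y := fun x y ↦ by
    rw [← hc x y]
    apply (chartAt (ℂ × ℂ) x).left_inv
    rw [TopologicalSpace.Opens.chartAt_eq, OpenPartialHomeomorph.subtypeRestr_source]
    exact Set.mem_univ _
  rintro v ⟨hv, -⟩
  set x₀ := D.surjective_proj.hasRightInverse.choose q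
  set x₀' := D.surjective_proj.hasRightInverse.choose q'
  have hv' : v ∈ ((L.trans (chartAt (ℂ × ℂ) x₀)).symm.trans
      (L'.trans (chartAt (ℂ × ℂ) x₀'))).source := hv
  rw [OpenPartialHomeomorph.trans_source] at hv'
  obtain ⟨hv1, hv2⟩ := hv'
  rw [OpenPartialHomeomorph.symm_source, OpenPartialHomeomorph.trans_target] at hv1
  obtain ⟨hv1, -⟩ := hv1
  rw [Set.mem_preimage, OpenPartialHomeomorph.trans_source] at hv2
  obtain ⟨hv2, -⟩ := hv2
  set x : HC := (chartAt (ℂ × ℂ) x₀).symm v with hx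
  have hxv : x.1 = v := by
    rw [← hc x₀ x, hx]
    exact (chartAt (ℂ × ℂ) x₀).right_inv hv1
  replace hv2 : D.proj x ∈ L'.source := by
    rw [← hLs]
    exact hv2
  have hy : D.proj (L' (D.proj x)) = D.proj x := by
    rw [← hLs', L'.left_inv hv2]
  obtain ⟨γ, hγ⟩ := D.isQuotientCoveringMap_proj.apply_eq_iff_mem_orbit.1 hy
  replace hγ : γ • x = L' (D.proj x) := hγ
  obtain ⟨i, j, l, k, hnf⟩ := D.exists_nf γ.2
  have hsm : ∀ u : HC, (γ • u : HC) = D.nf i j l k u := fun u ↦ by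
    rw [← hnf]; rfl
  have hG : ContDiff 𝕜 n (fun u : ℂ × ℂ ↦ (((D.α ^ k : ℝ) : ℂ) * u.1
      + ((i * D.a 0 + j * D.a 1 : ℝ) : ℂ), (((ε ^ k : ℤˣ) : ℤ) : ℂ) * u.2
      + (((i * D.b 0 + j * D.b 1) * D.α ^ k : ℝ) : ℂ) * u.1
      + ((D.h i j + l * D.A : ℝ) : ℂ))) := by
    fun_prop
  refine (hG.contDiffAt.congr_of_eventuallyEq ?_).contDiffWithinAt
  have hT : (fun u : HC ↦ γ • u) ⁻¹' L'.target ∈ 𝓝 x := by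
    refine (continuous_const_smul γ).continuousAt.preimage_mem_nhds ?_
    rw [hγ]
    exact L'.open_target.mem_nhds (L'.map_source hv2)
  have hT' := HC.isOpen.isOpenMap_subtype_val.image_mem_nhds hT
  rw [hxv] at hT'
  filter_upwards [hT']
  rintro _ ⟨u, hu, rfl⟩
  have e1 : L.symm ((chartAt (ℂ × ℂ) x₀).symm u.1) = L'.symm (γ • u) := by
    rw [hcs, hLs, hLs', D.isQuotientCoveringMap_proj.map_smul]
  have e2 : L' (L.symm ((chartAt (ℂ × ℂ) x₀).symm u.1)) = γ • u := by
    rw [e1, L'.right_inv hu]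
  change (L' (L.symm ((chartAt (ℂ × ℂ) x₀).symm u.1))).1 = _
  rw [e2, hsm]
  rfl

/-- The surface is a complex manifold. -/
instance : IsManifold 𝓘(ℂ, ℂ × ℂ) ω D.Surface := D.isManifold ℂ ω

/-- The surface is a smooth real manifold. -/
instance : IsManifold 𝓘(ℝ, ℂ × ℂ) ∞ D.Surface := D.isManifold ℝ ∞

end Data

/-! ### The invariant forms on `ℍ × ℂ`

The forms are evaluated at `x = (z, w)` on tangent vectors `u, v ∈ ℂ × ℂ` written in the
coordinates `(z, w)`; the convention is `(φ ∧ ψ)(u, v) = φ(u) ψ(v) - φ(v) ψ(u)`. -/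

/-- `θ₁ = dz / Im z`. -/
noncomputable def θ₁ (x : HC) (u : ℂ × ℂ) : ℂ := u.1 / (x.1.1.im : ℂ)

/-- `θ₂ = dw - (Im w / Im z) dz`. -/
noncomputable def θ₂ (x : HC) (u : ℂ × ℂ) : ℂ := u.2 - (x.1.2.im : ℂ) / (x.1.1.im : ℂ) * u.1

/-- `Ω = θ₁ ∧ θ₂`. -/
noncomputable def Ω (x : HC) (u v : ℂ × ℂ) : ℂ := θ₁ x u * θ₂ x v - θ₁ x v * θ₂ x u

/-- `Ω₁ = Re (θ₁ ∧ conj θ₂)`. -/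
noncomputable def Ω₁ (x : HC) (u v : ℂ × ℂ) : ℝ :=
  (θ₁ x u * (starRingEnd ℂ) (θ₂ x v) - θ₁ x v * (starRingEnd ℂ) (θ₂ x u)).re

/-! ### Endomorphism fields and maps -/

/-- The complex structure of a complex surface `M`, seen as a field of real endomorphisms of the
tangent spaces: multiplication by `i` (in any holomorphic chart). -/
noncomputable def complexStructure (M : Type*) [TopologicalSpace M] [ChartedSpace (ℂ × ℂ) M]
    [IsManifold 𝓘(ℂ, ℂ × ℂ) ω M] : EndoField (E := ℂ × ℂ) M :=
  fun _ ↦ (Complex.I • ContinuousLinearMap.id ℝ (ℂ × ℂ) : (ℂ × ℂ) →L[ℝ] (ℂ × ℂ))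

/-- `J' ∘ dκ = dκ ∘ J`: the endomorphism fields `J` and `J'` are related by the map `κ`. -/
def Related {M M' : Type*} [TopologicalSpace M] [ChartedSpace (ℂ × ℂ) M]
    [TopologicalSpace M'] [ChartedSpace (ℂ × ℂ) M'] (κ : M → M')
    (J : EndoField (E := ℂ × ℂ) M) (J' : EndoField (E := ℂ × ℂ) M') : Prop :=
  ∀ (m : M) (v : TangentSpace 𝓘(ℝ, ℂ × ℂ) m),
    J' (κ m) (mfderiv 𝓘(ℝ, ℂ × ℂ) 𝓘(ℝ, ℂ × ℂ) κ m v)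
      = mfderiv 𝓘(ℝ, ℂ × ℂ) 𝓘(ℝ, ℂ × ℂ) κ m (J m v)

end Inoue

namespace Inoue

namespace Data

variable {ε : ℤˣ} (D : Data ε)

/-! ### Normal forms of the elements of the group -/

/-! Every deck transformation has derivative `(z, w) ↦ (s z, e w + β z)` with `s > 0`, `e = ±1` and
`β` real. Since the coefficients are real, this derivative commutes with `i` and with complex
conjugation. The constant endomorphisms `i`, `i conj` and `-conj` of `ℂ × ℂ` therefore descend to
every surface, of either sign, and having constant coefficients in all charts they are smooth and
integrable (`commutesWithCharts`, `EndoField.isSmooth_const`, `EndoField.isIntegrable_const`).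

The form `modelForm`, which is `Im (u₁ conj v₂ + v₁ conj u₂)`, is compatible with these three
endomorphisms, and the derivative above multiplies it by `s e` (`modelForm_lin`), while `Im z` is
multiplied by `s`. So `modelForm / Im z` is invariant up to the sign `e`. For determinant `1` that
sign is always `+`, and the form descends to a metric; its fundamental forms are `Ω₁`, `Re Ω`, `Im
Ω`. The map `φ₀` of `S^-` has `e = -1`, which makes `σ` an anti-isometry.

The groups are compared through the normal form `nf m n l k`. Its exponent `k` is visible in the
scaling of `Im z`, and the group of `S^+` consists of the elements with `k` even
(`mem_Γ_double_iff`). It is normalised by `φ₀`, has `φ₀` as second coset and contains `φ₀²`; all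
statements about `κ` and `σ` follow.

If `S^-` had a compatible metric, pull it back to `ℍ × ℂ` and evaluate it on the vectors `(1, 0)`
and `(0, i)`. Compatibility and nondegeneracy forbid the value zero (`form_ne_zero_of_compatible`),
but `φ₀` reverses the sign, against connectedness of `ℍ × ℂ` (`not_exists_compatible`). -/

theorem φ_pow (i : Fin 2) (m : ℤ) : D.φ i ^ m =
    aff 1 one_pos 1 (m * D.a i) (m * D.b i)
      (m * D.c i + 1 / 2 * (m * (m - 1)) * D.a i * D.b i) := by
  induction m using Int.induction_on with
  | zero =>
    rw [zpow_zero, ← aff_one]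
    apply aff_congr <;> simp
  | succ k ih =>
    rw [zpow_add_one, ih, φ, aff_mul]
    apply aff_congr <;> push_cast <;> simp <;> ring
  | pred k ih =>
    rw [zpow_sub_one, ih, mul_inv_eq_iff_eq_mul, φ, aff_mul]
    apply aff_congr <;> push_cast <;> simp <;> ring

theorem φ₃_pow (l : ℤ) : D.φ₃ ^ l = aff 1 one_pos 1 0 0 (l * D.A) := by
  induction l using Int.induction_on with
  | zero =>
    rw [zpow_zero, ← aff_one]
    apply aff_congr <;> simp
  | succ k ih =>
    rw [zpow_add_one, ih, φ₃, aff_mul]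
    apply aff_congr <;> push_cast <;> simp
    ring
  | pred k ih =>
    rw [zpow_sub_one, ih, mul_inv_eq_iff_eq_mul, φ₃, aff_mul]
    apply aff_congr <;> push_cast <;> simp
    ring

theorem nf_mul_φ₀ (m n l k : ℤ) : D.nf m n l k * D.φ₀ = D.nf m n l (k + 1) := by
  rw [nf, nf, φ₀, aff_mul]
  apply aff_congr
  · rw [zpow_add_one₀ D.α_pos.ne']
  · rw [zpow_add_one]
  · simp
  · rw [zpow_add_one₀ D.α_pos.ne']
    simp [mul_assoc]
  · simp

theorem φ₀_mem : D.φ₀ ∈ D.Γ := Subgroup.subset_closure (by simp)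

theorem φ_mem (i : Fin 2) : D.φ i ∈ D.Γ :=
  Subgroup.subset_closure (by fin_cases i <;> simp)

theorem φ₃_mem : D.φ₃ ∈ D.Γ := Subgroup.subset_closure (by simp)

theorem nf_zero_mem (m n l : ℤ) : D.nf m n l 0 ∈ D.Γ := by
  have : D.nf m n l 0 = D.φ 0 ^ m * D.φ 1 ^ n * D.φ₃ ^ l := by
    rw [φ_pow, φ_pow, φ₃_pow, aff_mul, aff_mul, nf]
    apply aff_congr <;> simp [h] <;> ring
  rw [this]
  exact mul_mem (mul_mem (zpow_mem (D.φ_mem 0) _) (zpow_mem (D.φ_mem 1) _)) (zpow_mem D.φ₃_mem _)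

/-- Converse of `exists_nf`: the group is exactly the set of normal forms. The power of `φ₀` is
built up one factor at a time, and for negative `k` the factor is cancelled instead. -/
theorem nf_mem (m n l k : ℤ) : D.nf m n l k ∈ D.Γ := by
  induction k using Int.induction_on with
  | zero => exact D.nf_zero_mem m n l
  | succ k ih =>
    rw [← nf_mul_φ₀]
    exact mul_mem ih D.φ₀_mem
  | pred k ih =>
    have : D.nf m n l (-k) = D.nf m n l (-k - 1) * D.φ₀ := by
      rw [nf_mul_φ₀, sub_add_cancel]
    rw [this] at ih
    exact (Subgroup.mul_mem_cancel_right _ D.φ₀_mem).1 ih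

/-- All translation parameters are real, so only the power of `φ₀` is seen by `Im z`. As `α > 1`,
this recovers `k` from the transformation. -/
theorem nf_im (m n l k : ℤ) (x : HC) : (D.nf m n l k x).1.1.im = D.α ^ k * x.1.1.im := by
  rw [nf, aff_val]
  simp only [Complex.add_im, Complex.im_ofReal_mul, Complex.ofReal_im, add_zero]

theorem proj_eq_iff {x y : HC} : D.proj x = D.proj y ↔ ∃ γ ∈ D.Γ, γ y = x := by
  rw [D.isQuotientCoveringMap_proj.apply_eq_iff_mem_orbit]
  constructor
  · rintro ⟨γ, h⟩
    exact ⟨γ, γ.2, h⟩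
  · rintro ⟨γ, hγ, h⟩
    exact ⟨⟨γ, hγ⟩, h⟩

/-! ### The surface of type `S^+` covering a surface of type `S^-` -/

section Double

variable (D : Data (-1))

/-- Two applications of `exists_h`, for which the signs `ε = -1` cancel. On the two basis vectors
this is the equation that `c` has to satisfy for `N²`, and the integer `j` supplies `p'` and `q'`.
-/
theorem exists_h_sq (m n : ℤ) : ∃ j : ℤ, D.h m n =
    D.h (m * (D.N ^ 2) 0 0 + n * (D.N ^ 2) 1 0) (m * (D.N ^ 2) 0 1 + n * (D.N ^ 2) 1 1)
      + j * D.A := by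
  obtain ⟨j, hj⟩ := D.exists_h m n
  obtain ⟨j', hj'⟩ := D.exists_h (m * D.N 0 0 + n * D.N 1 0) (m * D.N 0 1 + n * D.N 1 1)
  refine ⟨j' - j, ?_⟩
  have e1 : m * (D.N ^ 2) 0 0 + n * (D.N ^ 2) 1 0 =
      (m * D.N 0 0 + n * D.N 1 0) * D.N 0 0 + (m * D.N 0 1 + n * D.N 1 1) * D.N 1 0 := by
    simp only [pow_two, Matrix.mul_apply, Fin.sum_univ_two]
    ring
  have e2 : m * (D.N ^ 2) 0 1 + n * (D.N ^ 2) 1 1 =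
      (m * D.N 0 0 + n * D.N 1 0) * D.N 0 1 + (m * D.N 0 1 + n * D.N 1 1) * D.N 1 1 := by
    simp only [pow_two, Matrix.mul_apply, Fin.sum_univ_two]
    ring
  rw [e1, e2]
  push_cast at hj hj' ⊢
  linear_combination hj' - hj

/-- The data defining the surface of type `S^+` that covers the surface of type `S^-`. -/
noncomputable def double : Data 1 where
  N := D.N ^ 2
  -- The same `c` is kept. The value of `h` at the `i`-th row of `N²` is the `i`-th entry of `N² c +
  -- e`, so the linear system holds with these integers.
  p := (D.exists_h_sq 1 0).choose
  q := (D.exists_h_sq 0 1).choose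
  r := D.r
  α := D.α ^ 2
  a := D.a
  b := D.b
  c := D.c
  r_ne_zero := D.r_ne_zero
  one_lt_α := one_lt_pow₀ D.one_lt_α two_ne_zero
  det_N := by rw [Matrix.det_pow, D.det_N]; simp
  a_ne_zero := D.a_ne_zero
  b_ne_zero := D.b_ne_zero
  N_mulVec_a := by
    have : (D.N ^ 2).map (Int.cast : ℤ → ℝ) = (D.N.map (Int.cast : ℤ → ℝ)) ^ 2 :=
      map_pow (Int.castRingHom ℝ).mapMatrix D.N 2
    rw [this, pow_two, ← Matrix.mulVec_mulVec, D.N_mulVec_a, Matrix.mulVec_smul, D.N_mulVec_a,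
      smul_smul, pow_two]
  N_mulVec_b := by
    have : (D.N ^ 2).map (Int.cast : ℤ → ℝ) = (D.N.map (Int.cast : ℤ → ℝ)) ^ 2 :=
      map_pow (Int.castRingHom ℝ).mapMatrix D.N 2
    rw [this, pow_two, ← Matrix.mulVec_mulVec, D.N_mulVec_b, Matrix.mulVec_smul, D.N_mulVec_b,
      smul_smul]
    congr 1
    push_cast
    rw [div_mul_div_comm]
    norm_num [pow_two]
  c_eq i := by
    fin_cases i
    · have := (D.exists_h_sq 1 0).choose_spec
      simp [h, A] at this ⊢
      linear_combination this
    · have := (D.exists_h_sq 0 1).choose_spec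
      simp [h, A] at this ⊢
      linear_combination this

theorem double_nf (m n l k : ℤ) : D.double.nf m n l k = D.nf m n l (2 * k) := by
  rw [nf, nf]
  apply aff_congr
  · rw [zpow_mul]; rfl
  · rw [zpow_mul]; simp
  · rfl
  · rw [zpow_mul]; rfl
  · rfl

theorem Γ_double_le : D.double.Γ ≤ D.Γ := by
  intro γ hγ
  obtain ⟨m, n, l, k, rfl⟩ := D.double.exists_nf hγ
  rw [double_nf]
  exact D.nf_mem _ _ _ _

theorem double_φ₀ : D.φ₀ * D.φ₀ = D.double.φ₀ := by
  rw [φ₀, φ₀, aff_mul]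
  apply aff_congr <;> simp [double, pow_two]

/-- Normal forms for the doubled data are those of `D` with exponent `2 k`, and the exponent is
determined by the effect on `Im z`; evaluation at a single point is enough. -/
theorem mem_Γ_double_iff {m n l k : ℤ} : D.nf m n l k ∈ D.double.Γ ↔ Even k := by
  constructor
  · intro hγ
    obtain ⟨m', n', l', k', e⟩ := D.double.exists_nf hγ
    rw [double_nf] at e
    have x : HC := ⟨(Complex.I, 0), by change 0 < Complex.I.im; simp⟩
    have := D.nf_im m n l k x
    rw [e, nf_im] at this
    have hx : 0 < x.1.1.im := x.2
    have := mul_right_cancel₀ hx.ne' this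
    have := (zpow_right_strictMono₀ D.one_lt_α).injective this
    exact ⟨k', by omega⟩
  · rintro ⟨j, rfl⟩
    rw [← two_mul, ← double_nf]
    exact D.double.nf_mem _ _ _ _

/-- Some normal form exists by `exists_nf`, and comparing imaginary parts at one point forces its
exponent. The other three integers need not be computed. -/
theorem exists_nf_φ₀_mul (m n l k : ℤ) :
    ∃ m' n' l', D.φ₀ * D.nf m n l k = D.nf m' n' l' (k + 1) := by
  obtain ⟨m', n', l', k', e⟩ := D.exists_nf (mul_mem D.φ₀_mem (D.nf_mem m n l k))
  refine ⟨m', n', l', ?_⟩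
  let x : HC := ⟨(Complex.I, 0), by change 0 < Complex.I.im; simp⟩
  have h1 := D.nf_im m' n' l' k' x
  have h2 : ((D.φ₀ * D.nf m n l k) x).1.1.im = D.α ^ (k + 1) * x.1.1.im := by
    rw [Equiv.Perm.mul_apply, φ₀, aff_val, zpow_add_one₀ D.α_pos.ne']
    have := D.nf_im m n l k x
    simp only [Complex.add_im, Complex.im_ofReal_mul, Complex.ofReal_im, add_zero, this]
    ring
  rw [← e, h2] at h1
  have hx : 0 < x.1.1.im := x.2
  have := (zpow_right_strictMono₀ D.one_lt_α).injective (mul_right_cancel₀ hx.ne' h1)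
  rw [e, this]

/-- The map `S^+ → S^-` induced by the identity of `ℍ × ℂ`. -/
noncomputable def κ : D.double.Surface → D.Surface :=
  Quotient.lift D.proj fun _ _ h ↦ by
    obtain ⟨γ, hγ, e⟩ := D.double.proj_eq_iff.1 (Quotient.sound h)
    exact D.proj_eq_iff.2 ⟨γ, D.Γ_double_le hγ, e⟩

theorem κ_proj (x : HC) : D.κ (D.double.proj x) = D.proj x := rfl

/-- Conjugation by `φ₀` keeps the exponent, hence its parity. This is what lets `φ₀` induce a map of
`S^+`. -/
theorem φ₀_mul_mul_inv_mem {γ : Equiv.Perm HC} (hγ : γ ∈ D.double.Γ) :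
    D.φ₀ * γ * D.φ₀⁻¹ ∈ D.double.Γ := by
  obtain ⟨m, n, l, k, rfl⟩ := D.double.exists_nf hγ
  obtain ⟨m', n', l', e⟩ := D.exists_nf_φ₀_mul m n l (2 * k)
  rw [double_nf, e, ← nf_mul_φ₀, mul_inv_cancel_right, ← double_nf]
  exact D.double.nf_mem _ _ _ _

/-- The involution of `S^+` induced by `(z, w) ↦ (α z, -w)`. -/
noncomputable def σ : D.double.Surface → D.double.Surface :=
  Quotient.lift (fun x ↦ D.double.proj (D.φ₀ x)) fun _ y h ↦ by
    obtain ⟨γ, hγ, e⟩ := D.double.proj_eq_iff.1 (Quotient.sound h)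
    refine D.double.proj_eq_iff.2 ⟨_, D.φ₀_mul_mul_inv_mem hγ, ?_⟩
    simp [e]

theorem σ_proj (x : HC) : D.σ (D.double.proj x) = D.double.proj (D.φ₀ x) := rfl

theorem σ_σ (m : D.double.Surface) : D.σ (D.σ m) = m := by
  obtain ⟨x, rfl⟩ := D.double.surjective_proj m
  rw [σ_proj, σ_proj, D.double.proj_eq_iff]
  exact ⟨_, D.double.φ₀_mem, by rw [← double_φ₀]; rfl⟩

/-- The larger group is the union of the smaller one and its coset through `φ₀`, according to the
parity of the exponent. -/
theorem κ_eq_κ_iff (m m' : D.double.Surface) : D.κ m = D.κ m' ↔ m' = m ∨ m' = D.σ m := by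
  obtain ⟨x, rfl⟩ := D.double.surjective_proj m
  obtain ⟨y, rfl⟩ := D.double.surjective_proj m'
  rw [κ_proj, κ_proj, σ_proj, eq_comm, D.proj_eq_iff, D.double.proj_eq_iff, D.double.proj_eq_iff]
  constructor
  · rintro ⟨γ, hγ, rfl⟩
    obtain ⟨m, n, l, k, rfl⟩ := D.exists_nf hγ
    rcases Int.even_or_odd k with hk | ⟨j, rfl⟩
    · exact Or.inl ⟨_, D.mem_Γ_double_iff.2 hk, rfl⟩
    · refine Or.inr ⟨D.nf m n l (2 * j), D.mem_Γ_double_iff.2 (even_two_mul j), ?_⟩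
      rw [← nf_mul_φ₀]
      rfl
  · rintro (⟨γ, hγ, rfl⟩ | ⟨γ, hγ, rfl⟩)
    · exact ⟨γ, D.Γ_double_le hγ, rfl⟩
    · exact ⟨γ * D.φ₀, mul_mem (D.Γ_double_le hγ) D.φ₀_mem, rfl⟩

theorem mul_φ₀_ne_one {γ : Equiv.Perm HC} (hγ : γ ∈ D.double.Γ) : γ * D.φ₀ ≠ 1 := by
  intro h
  obtain ⟨m, n, l, k, rfl⟩ := D.double.exists_nf hγ
  rw [double_nf, nf_mul_φ₀] at h
  have h1 : D.nf m n l (2 * k + 1) ∈ D.double.Γ := by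
    rw [h]; exact one_mem _
  rw [mem_Γ_double_iff] at h1
  exact (Int.not_even_two_mul_add_one k) h1

/-- Take the image of a neighbourhood that no nontrivial element of the larger group `D.Γ` moves
onto a set meeting it. If `σ` sent a point of the image into the image, some `γ * φ₀` would be
trivial, although its exponent is odd. Both the absence of fixed points and the covering property
rest on this. -/
theorem exists_nhds_σ_disjoint (m : D.double.Surface) :
    ∃ U ∈ 𝓝 m, ∀ u ∈ U, D.σ u ∉ U := by
  obtain ⟨x, rfl⟩ := D.double.surjective_proj m
  obtain ⟨V, hV, h⟩ := D.exists_nhds_disjoint x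
  refine ⟨D.double.proj '' V, D.double.isLocalHomeomorph_proj.isOpenMap.image_mem_nhds hV, ?_⟩
  rintro _ ⟨v, hv, rfl⟩ ⟨w, hw, e⟩
  rw [σ_proj] at e
  obtain ⟨γ, hγ, e⟩ := D.double.proj_eq_iff.1 e
  have := h ⟨γ * D.φ₀, mul_mem (D.Γ_double_le hγ) D.φ₀_mem⟩ ⟨w, ⟨v, hv, e⟩, hw⟩
  exact D.mul_φ₀_ne_one hγ (congrArg Subtype.val this)

theorem σ_ne (m : D.double.Surface) : D.σ m ≠ m := by
  obtain ⟨U, hU, h⟩ := D.exists_nhds_σ_disjoint m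
  intro e
  have := h m (mem_of_mem_nhds hU)
  rw [e] at this
  exact this (mem_of_mem_nhds hU)

theorem continuous_σ : Continuous D.σ := by
  refine Continuous.quotient_lift (D.double.isLocalHomeomorph_proj.continuous.comp ?_) _
  exact continuous_aff _ _ _ _ _ _

theorem continuous_κ : Continuous D.κ :=
  Continuous.quotient_lift D.isLocalHomeomorph_proj.continuous _

/-- `κ` is the quotient map for the two-element group generated by `σ`, acting freely with the
disjoint neighbourhoods found above. -/
theorem isCoveringMap_κ : IsCoveringMap D.κ := by
  let s : Equiv.Perm D.double.Surface := ⟨D.σ, D.σ, D.σ_σ, D.σ_σ⟩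
  have hs2 : s ^ (2 : ℤ) = 1 := by
    ext m
    exact D.σ_σ m
  have hs : ∀ g : Subgroup.zpowers s, (g : Equiv.Perm D.double.Surface) = 1 ∨
      (g : Equiv.Perm D.double.Surface) = s := by
    rintro ⟨_, k, rfl⟩
    rcases Int.even_or_odd' k with ⟨j, rfl | rfl⟩
    · left
      simp only [zpow_mul, hs2, one_zpow]
    · right
      simp only [zpow_add, zpow_mul, hs2, one_zpow, one_mul, zpow_one]
  have hq : Topology.IsQuotientMap D.κ :=
    Topology.IsQuotientMap.of_comp (f := D.double.proj) D.double.isLocalHomeomorph_proj.continuous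
      D.continuous_κ D.isQuotientCoveringMap_proj.toIsQuotientMap
  have : IsQuotientCoveringMap D.κ (Subgroup.zpowers s) :=
    { hq with
      continuous_const_smul := fun g ↦ by
        change Continuous (g : Equiv.Perm D.double.Surface)
        rcases hs g with h | h <;> rw [h]
        · exact continuous_id
        · exact D.continuous_σ
      apply_eq_iff_mem_orbit := fun {m m'} ↦ by
        rw [eq_comm, κ_eq_κ_iff]
        constructor
        · rintro (rfl | rfl)
          · exact MulAction.mem_orbit_self _
          · exact ⟨⟨s, Subgroup.mem_zpowers s⟩, rfl⟩
        · rintro ⟨g, rfl⟩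
          rcases hs g with h | h
          · left
            change (g : Equiv.Perm D.double.Surface) m' = m'
            rw [h]; rfl
          · right
            change (g : Equiv.Perm D.double.Surface) m' = D.σ m'
            rw [h]; rfl
      disjoint := fun m ↦ by
        obtain ⟨U, hU, h⟩ := D.exists_nhds_σ_disjoint m
        refine ⟨U, hU, ?_⟩
        rintro g ⟨_, ⟨u, hu, rfl⟩, hu'⟩
        rcases hs g with hg | hg
        · exact Subtype.ext hg
        · refine absurd ?_ (h u hu)
          change (g : Equiv.Perm D.double.Surface) u ∈ U at hu'
          rwa [hg] at hu' }
  exact this.isCoveringMap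

end Double

end Data

/-! ### The projection in the charts of the surface -/

/-- The map `(z, w) ↦ (s z + u, e w + β z + δ)` of `ℂ × ℂ`. -/
noncomputable def affMap (s : ℝ) (e : ℤˣ) (u β δ : ℝ) (x : ℂ × ℂ) : ℂ × ℂ :=
  (s * x.1 + u, ((e : ℤ) : ℂ) * x.2 + β * x.1 + δ)

theorem contDiff_affMap (𝕜 : Type) [NontriviallyNormedField 𝕜] [NormedAlgebra 𝕜 ℂ] (n : ℕ∞ω)
    (s : ℝ) (e : ℤˣ) (u β δ : ℝ) : ContDiff 𝕜 n (affMap s e u β δ) := by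
  unfold affMap
  fun_prop

/-- The linear map `(z, w) ↦ (s z, e w + β z)` of `ℂ × ℂ`. -/
noncomputable def lin (s : ℝ) (e : ℤˣ) (β : ℝ) : (ℂ × ℂ) →L[ℝ] (ℂ × ℂ) :=
  (s • ContinuousLinearMap.fst ℝ ℂ ℂ).prod
    (((e : ℤ) : ℝ) • ContinuousLinearMap.snd ℝ ℂ ℂ + β • ContinuousLinearMap.fst ℝ ℂ ℂ)

theorem lin_apply (s : ℝ) (e : ℤˣ) (β : ℝ) (x : ℂ × ℂ) :
    lin s e β x = (s * x.1, ((e : ℤ) : ℂ) * x.2 + β * x.1) := by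
  simp [lin]

theorem lin_injective {s : ℝ} (hs : 0 < s) (e : ℤˣ) (β : ℝ) :
    Function.Injective (lin s e β) := by
  refine (injective_iff_map_eq_zero _).2 fun x hx ↦ ?_
  have hs' : (s : ℂ) ≠ 0 := by exact_mod_cast hs.ne'
  rw [lin_apply, Prod.mk_eq_zero] at hx
  have h1 : x.1 = 0 := by simpa [hs'] using hx.1
  have h2 : x.2 = 0 := by simpa [h1] using hx.2
  exact Prod.ext h1 h2

theorem hasFDerivAt_affMap (s : ℝ) (e : ℤˣ) (u β δ : ℝ) (x : ℂ × ℂ) :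
    HasFDerivAt (affMap s e u β δ) (lin s e β) x := by
  have : affMap s e u β δ = fun x ↦ lin s e β x + ((u : ℂ), (δ : ℂ)) := by
    ext1 x
    simp [affMap, lin_apply]
  rw [this]
  exact (lin s e β).hasFDerivAt.add_const _

theorem hasMFDerivAt_val (x : HC) : HasMFDerivAt 𝓘(ℝ, ℂ × ℂ) 𝓘(ℝ, ℂ × ℂ)
    (Subtype.val : HC → ℂ × ℂ) x (ContinuousLinearMap.id ℝ (ℂ × ℂ)) := by
  have h : MDifferentiableAt 𝓘(ℝ, ℂ × ℂ) 𝓘(ℝ, ℂ × ℂ) (Subtype.val : HC → ℂ × ℂ) x :=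
    (contMDiff_subtype_val (n := 1)).mdifferentiableAt one_ne_zero
  have e : mfderiv 𝓘(ℝ, ℂ × ℂ) 𝓘(ℝ, ℂ × ℂ) (Subtype.val : HC → ℂ × ℂ) x =
      ContinuousLinearMap.id ℝ (ℂ × ℂ) :=
    mfderiv_extChartAt_self (I := 𝓘(ℝ, ℂ × ℂ)) (x := x)
  rw [← e]
  exact h.hasMFDerivAt

theorem contMDiffAt_of_val {𝕜 : Type} [NontriviallyNormedField 𝕜] [NormedAlgebra 𝕜 ℂ] {n : ℕ∞ω}
    {M : Type*} [TopologicalSpace M] [ChartedSpace (ℂ × ℂ) M] {f : M → HC} {x : M}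
    (h : ContMDiffAt 𝓘(𝕜, ℂ × ℂ) 𝓘(𝕜, ℂ × ℂ) n (fun y ↦ (f y).1) x) :
    ContMDiffAt 𝓘(𝕜, ℂ × ℂ) 𝓘(𝕜, ℂ × ℂ) n f x := by
  rw [contMDiffAt_iff_target]
  exact ⟨Topology.IsInducing.subtypeVal.continuousAt_iff.2 h.continuousAt, h⟩

theorem contMDiff_aff (𝕜 : Type) [NontriviallyNormedField 𝕜] [NormedAlgebra 𝕜 ℂ] (n : ℕ∞ω)
    (s : ℝ) (hs : 0 < s) (e : ℤˣ) (u β δ : ℝ) :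
    ContMDiff 𝓘(𝕜, ℂ × ℂ) 𝓘(𝕜, ℂ × ℂ) n (aff s hs e u β δ) := fun _ ↦
  contMDiffAt_of_val
    (((contDiff_affMap 𝕜 n s e u β δ).contMDiff.comp contMDiff_subtype_val).contMDiffAt)

theorem hasMFDerivAt_affMap_val (s : ℝ) (e : ℤˣ) (u β δ : ℝ) (x : HC) :
    HasMFDerivAt 𝓘(ℝ, ℂ × ℂ) 𝓘(ℝ, ℂ × ℂ) (fun x : HC ↦ affMap s e u β δ x.1) x (lin s e β) := by
  have := (hasFDerivAt_affMap s e u β δ x.1).hasMFDerivAt.comp x (hasMFDerivAt_val x)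
  exact this

namespace Data

variable {ε : ℤˣ} (D : Data ε)

/-- The point of `ℍ × ℂ` above `q` that serves to define the chart at `q`. -/
noncomputable def lift (q : D.Surface) : HC := D.surjective_proj.hasRightInverse.choose q

theorem proj_lift (q : D.Surface) : D.proj (D.lift q) = q :=
  D.surjective_proj.hasRightInverse.choose_spec q

theorem chartAt_apply (q q' : D.Surface) :
    chartAt (ℂ × ℂ) q q' = (D.isLocalHomeomorph_proj.localInverseAt (D.lift q) q').1 := rfl

theorem chartAt_source (q : D.Surface) :
    (chartAt (ℂ × ℂ) q).source = (D.isLocalHomeomorph_proj.localInverseAt (D.lift q)).source := by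
  have : chartAt (ℂ × ℂ) q = (D.isLocalHomeomorph_proj.localInverseAt (D.lift q)).trans
    (chartAt (ℂ × ℂ) (D.lift q)) := rfl
  rw [this, OpenPartialHomeomorph.trans_source, TopologicalSpace.Opens.chartAt_eq,
    OpenPartialHomeomorph.subtypeRestr_source]
  exact (Set.inter_eq_left.2 fun _ _ ↦ Set.mem_univ _)

theorem chartAt_self (q : D.Surface) : chartAt (ℂ × ℂ) q q = (D.lift q).1 := by
  rw [chartAt_apply]
  nth_rw 2 [← D.proj_lift q]
  rw [IsLocalHomeomorph.localInverseAt_apply_self]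

/-- The local inverses of the projection differ from the identity by elements of the group. -/
theorem exists_localInverseAt_proj {x₀ x : HC}
    (hx : D.proj x ∈ (D.isLocalHomeomorph_proj.localInverseAt x₀).source) :
    ∃ m n l k : ℤ, ∀ᶠ u in 𝓝 x,
      D.isLocalHomeomorph_proj.localInverseAt x₀ (D.proj u) = D.nf m n l k u := by
  set L := D.isLocalHomeomorph_proj.localInverseAt x₀ with hL
  have hLs : ∀ x, L.symm x = D.proj x := fun x ↦ by rw [hL, IsLocalHomeomorph.localInverseAt_symm]
  have hy : D.proj (L (D.proj x)) = D.proj x := by rw [← hLs, L.left_inv hx]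
  obtain ⟨γ, hγ, e⟩ := D.proj_eq_iff.1 hy
  obtain ⟨m, n, l, k, rfl⟩ := D.exists_nf hγ
  refine ⟨m, n, l, k, ?_⟩
  have hT : D.nf m n l k ⁻¹' L.target ∈ 𝓝 x := by
    refine (continuous_aff _ _ _ _ _ _).continuousAt.preimage_mem_nhds ?_
    change L.target ∈ 𝓝 (D.nf m n l k x)
    rw [e]
    exact L.open_target.mem_nhds (L.map_source hx)
  filter_upwards [hT] with u hu
  have : D.proj u = L.symm (D.nf m n l k u) := by
    rw [hLs]
    exact (D.proj_eq_iff.2 ⟨_, hγ, rfl⟩).symm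
  rw [this, L.right_inv hu]

theorem exists_chartAt_proj {q : D.Surface} {x : HC}
    (hx : D.proj x ∈ (chartAt (ℂ × ℂ) q).source) :
    ∃ m n l k : ℤ, ∀ᶠ u in 𝓝 x, chartAt (ℂ × ℂ) q (D.proj u) = (D.nf m n l k u).1 := by
  rw [chartAt_source] at hx
  obtain ⟨m, n, l, k, h⟩ := D.exists_localInverseAt_proj hx
  refine ⟨m, n, l, k, ?_⟩
  filter_upwards [h] with u hu
  rw [chartAt_apply, hu]

/-! ### Regularity of the projection and of the maps it induces, over `ℝ` and `ℂ` alike. -/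

variable (𝕜 : Type) [NontriviallyNormedField 𝕜] [NormedAlgebra 𝕜 ℂ] (n : ℕ∞ω)

theorem contMDiff_proj : ContMDiff 𝓘(𝕜, ℂ × ℂ) 𝓘(𝕜, ℂ × ℂ) n D.proj := by
  intro x
  rw [contMDiffAt_iff_target]
  refine ⟨D.isLocalHomeomorph_proj.continuous.continuousAt, ?_⟩
  obtain ⟨i, j, l, k, h⟩ := D.exists_chartAt_proj (mem_chart_source (ℂ × ℂ) (D.proj x))
  refine ContMDiffAt.congr_of_eventuallyEq ?_ h
  exact ((contDiff_affMap 𝕜 n _ _ _ _ _).contMDiff.comp contMDiff_subtype_val).contMDiffAt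

/-- Near `q`, the branch of the inverse through `x` is a group element composed with the branch
through `D.lift q`. The latter is the chart at `q`, and the group acts by affine maps. -/
theorem contMDiffOn_localInverseAt (x : HC) :
    ContMDiffOn 𝓘(𝕜, ℂ × ℂ) 𝓘(𝕜, ℂ × ℂ) n (D.isLocalHomeomorph_proj.localInverseAt x)
      (D.isLocalHomeomorph_proj.localInverseAt x).source := by
  have := D.isManifold 𝕜 n
  intro q hq
  refine ContMDiffAt.contMDiffWithinAt (contMDiffAt_of_val ?_)
  rw [← D.proj_lift q] at hq
  obtain ⟨i, j, l, k, h⟩ := D.exists_localInverseAt_proj hq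
  set L := D.isLocalHomeomorph_proj.localInverseAt (D.lift q) with hL
  have hs : q ∈ L.source := by
    rw [hL, ← chartAt_source]
    exact mem_chart_source _ q
  have hLq : L q = D.lift q := Subtype.ext (D.chartAt_self q)
  have h1 : ContMDiffAt 𝓘(𝕜, ℂ × ℂ) 𝓘(𝕜, ℂ × ℂ) n (chartAt (ℂ × ℂ) q) q :=
    contMDiffAt_of_mem_maximalAtlas (IsManifold.chart_mem_maximalAtlas q) (mem_chart_source _ q)
  have h2 := (contDiff_affMap 𝕜 n (D.α ^ k) (ε ^ k) (i * D.a 0 + j * D.a 1)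
    ((i * D.b 0 + j * D.b 1) * D.α ^ k) (D.h i j + l * D.A)).contMDiff.contMDiffAt.comp q h1
  refine h2.congr_of_eventuallyEq ?_
  have h3 := L.continuousAt hs
  rw [ContinuousAt, hLq] at h3
  filter_upwards [h3.eventually h, L.open_source.mem_nhds hs] with q' hq' hq's
  rw [D.isLocalHomeomorph_proj.apply_localInverseAt_of_mem hq's] at hq'
  rw [hq']
  rfl

/-- The projection as a diffeomorphism between open sets. -/
noncomputable def projDiffeo (x : HC) :
    PartialDiffeomorph 𝓘(𝕜, ℂ × ℂ) 𝓘(𝕜, ℂ × ℂ) HC D.Surface n where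
  toFun := D.proj
  invFun := D.isLocalHomeomorph_proj.localInverseAt x
  source := (D.isLocalHomeomorph_proj.localInverseAt x).target
  target := (D.isLocalHomeomorph_proj.localInverseAt x).source
  map_source' y hy := by
    have := (D.isLocalHomeomorph_proj.localInverseAt x).map_target hy
    rwa [D.isLocalHomeomorph_proj.localInverseAt_symm x] at this
  map_target' y hy := (D.isLocalHomeomorph_proj.localInverseAt x).map_source hy
  left_inv' y hy := by
    have := (D.isLocalHomeomorph_proj.localInverseAt x).right_inv hy
    rwa [D.isLocalHomeomorph_proj.localInverseAt_symm x] at this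
  right_inv' y hy := D.isLocalHomeomorph_proj.apply_localInverseAt_of_mem hy
  open_source := (D.isLocalHomeomorph_proj.localInverseAt x).open_target
  open_target := (D.isLocalHomeomorph_proj.localInverseAt x).open_source
  contMDiffOn_toFun := (D.contMDiff_proj 𝕜 n).contMDiffOn
  contMDiffOn_invFun := D.contMDiffOn_localInverseAt 𝕜 n x

theorem isLocalDiffeomorph_proj :
    IsLocalDiffeomorph 𝓘(𝕜, ℂ × ℂ) 𝓘(𝕜, ℂ × ℂ) n D.proj := fun x ↦
  ⟨D.projDiffeo 𝕜 n x, D.isLocalHomeomorph_proj.self_mem_localInverseAt_target, fun _ _ ↦ rfl⟩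

/-- A map that lifts to a local diffeomorphism from `ℍ × ℂ` is a local diffeomorphism. -/
theorem isLocalDiffeomorph_of_comp_proj {M : Type*} [TopologicalSpace M]
    [ChartedSpace (ℂ × ℂ) M] {f : D.Surface → M}
    (hf : IsLocalDiffeomorph 𝓘(𝕜, ℂ × ℂ) 𝓘(𝕜, ℂ × ℂ) n (f ∘ D.proj)) :
    IsLocalDiffeomorph 𝓘(𝕜, ℂ × ℂ) 𝓘(𝕜, ℂ × ℂ) n f := by
  intro q
  obtain ⟨x, rfl⟩ := D.surjective_proj q
  obtain ⟨Φ, hx, h⟩ := hf x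
  have hy := D.isLocalHomeomorph_proj.localInverseAt_apply_self (x := x)
  refine ⟨(D.projDiffeo 𝕜 n x).symm.trans Φ,
    ⟨D.isLocalHomeomorph_proj.apply_self_mem_localInverseAt_source, ?_⟩, ?_⟩
  · change D.isLocalHomeomorph_proj.localInverseAt x (D.proj x) ∈ Φ.source
    rwa [hy]
  · rintro q ⟨hq, hq'⟩
    have := h hq'
    change f (D.proj (D.isLocalHomeomorph_proj.localInverseAt x q)) = _ at this
    rw [D.isLocalHomeomorph_proj.apply_localInverseAt_of_mem hq] at this
    exact this

theorem contMDiff_of_comp_proj {M : Type*} [TopologicalSpace M]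
    [ChartedSpace (ℂ × ℂ) M] {f : D.Surface → M}
    (hf : ContMDiff 𝓘(𝕜, ℂ × ℂ) 𝓘(𝕜, ℂ × ℂ) n (f ∘ D.proj)) :
    ContMDiff 𝓘(𝕜, ℂ × ℂ) 𝓘(𝕜, ℂ × ℂ) n f := by
  intro q
  obtain ⟨x, rfl⟩ := D.surjective_proj q
  have hs : D.proj x ∈ (D.isLocalHomeomorph_proj.localInverseAt x).source :=
    D.isLocalHomeomorph_proj.apply_self_mem_localInverseAt_source
  have hn := (D.isLocalHomeomorph_proj.localInverseAt x).open_source.mem_nhds hs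
  have := hf.contMDiffAt.comp _ ((D.contMDiffOn_localInverseAt 𝕜 n x).contMDiffAt hn)
  refine this.congr_of_eventuallyEq ?_
  filter_upwards [hn] with q' hq'
  exact congrArg f (D.isLocalHomeomorph_proj.apply_localInverseAt_of_mem hq').symm

theorem isLocalDiffeomorph_κ (D : Data (-1)) :
    IsLocalDiffeomorph 𝓘(𝕜, ℂ × ℂ) 𝓘(𝕜, ℂ × ℂ) n D.κ :=
  D.double.isLocalDiffeomorph_of_comp_proj 𝕜 n (D.isLocalDiffeomorph_proj 𝕜 n)

theorem contMDiff_σ (D : Data (-1)) : ContMDiff 𝓘(𝕜, ℂ × ℂ) 𝓘(𝕜, ℂ × ℂ) n D.σ :=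
  D.double.contMDiff_of_comp_proj 𝕜 n
    ((D.double.contMDiff_proj 𝕜 n).comp (contMDiff_aff 𝕜 n _ _ _ _ _ _))

/-! ### Derivatives -/

theorem mdifferentiableAt_proj (x : HC) :
    MDifferentiableAt 𝓘(ℝ, ℂ × ℂ) 𝓘(ℝ, ℂ × ℂ) D.proj x :=
  (D.contMDiff_proj ℝ 1).mdifferentiableAt one_ne_zero

/-- The derivative of the projection, read in a chart of the surface. -/
theorem exists_mfderiv_extChartAt_comp {q : D.Surface} {x : HC}
    (hx : D.proj x ∈ (chartAt (ℂ × ℂ) q).source) :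
    ∃ (s : ℝ) (k : ℤ) (β : ℝ), 0 < s ∧
      (mfderiv 𝓘(ℝ, ℂ × ℂ) 𝓘(ℝ, ℂ × ℂ) (extChartAt 𝓘(ℝ, ℂ × ℂ) q) (D.proj x)) ∘L
        (mfderiv 𝓘(ℝ, ℂ × ℂ) 𝓘(ℝ, ℂ × ℂ) D.proj x) = lin s (ε ^ k) β ∧
      (chartAt (ℂ × ℂ) q (D.proj x)).1.im = s * x.1.1.im := by
  obtain ⟨i, j, l, k, h⟩ := D.exists_chartAt_proj hx
  -- The same `s = α ^ k` scales the derivative and `Im z`; the invariance of `modelForm / Im z`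
  -- depends on this coupling.
  refine ⟨D.α ^ k, k, (i * D.b 0 + j * D.b 1) * D.α ^ k, zpow_pos D.α_pos k, ?_, ?_⟩
  · have h1 := (hasMFDerivAt_affMap_val (D.α ^ k) (ε ^ k) (i * D.a 0 + j * D.a 1)
      ((i * D.b 0 + j * D.b 1) * D.α ^ k) (D.h i j + l * D.A) x).congr_of_eventuallyEq h
    have h2 := (mdifferentiableAt_extChartAt (I := 𝓘(ℝ, ℂ × ℂ)) hx).hasMFDerivAt.comp x
      (D.mdifferentiableAt_proj x).hasMFDerivAt
    exact hasMFDerivAt_unique h2 h1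
  · rw [h.self_of_nhds, nf_im]

theorem exists_mfderiv_proj (x : HC) :
    ∃ (s : ℝ) (k : ℤ) (β : ℝ), 0 < s ∧
      mfderiv 𝓘(ℝ, ℂ × ℂ) 𝓘(ℝ, ℂ × ℂ) D.proj x = lin s (ε ^ k) β ∧
      (D.lift (D.proj x)).1.1.im = s * x.1.1.im := by
  obtain ⟨s, k, β, hs, h, h'⟩ :=
    D.exists_mfderiv_extChartAt_comp (mem_chart_source (ℂ × ℂ) (D.proj x))
  rw [mfderiv_extChartAt_self] at h
  rw [chartAt_self] at h'
  exact ⟨s, k, β, hs, h, h'⟩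

end Data

end Inoue

/-! ### Endomorphism fields that are constant in the charts -/

section ConstantEndoField

variable {E : Type*} [NormedAddCommGroup E] [NormedSpace ℝ E]
  {M : Type*} [TopologicalSpace M] [ChartedSpace E M] [IsManifold 𝓘(ℝ, E) ∞ M]

/-- The derivative at `q` of the chart at `q₀`, read in the chart at `q`. -/
noncomputable def chartDeriv (q₀ q : M) : E →L[ℝ] E :=
  mfderiv 𝓘(ℝ, E) 𝓘(ℝ, E) (extChartAt 𝓘(ℝ, E) q₀) q

theorem chartDeriv_self (q : M) : chartDeriv (E := E) q q = ContinuousLinearMap.id ℝ E :=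
  mfderiv_extChartAt_self

theorem chartDeriv_eq_continuousLinearMapAt {q₀ q : M} (hq : q ∈ (chartAt E q₀).source) :
    (trivializationAt E (TangentSpace 𝓘(ℝ, E)) q₀).continuousLinearMapAt ℝ q =
      chartDeriv (E := E) q₀ q :=
  TangentBundle.continuousLinearMapAt_trivializationAt hq

theorem chartDeriv_symmL {q₀ q : M} (hq : q ∈ (chartAt E q₀).source) (v : E) :
    chartDeriv (E := E) q₀ q ((trivializationAt E (TangentSpace 𝓘(ℝ, E)) q₀).symmL ℝ q v) = v := by
  rw [← chartDeriv_eq_continuousLinearMapAt hq]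
  exact Bundle.Trivialization.continuousLinearMapAt_symmL _ hq v

/-- `L` commutes with the derivatives of all coordinate changes of `M`. -/
def CommutesWithCharts (M : Type*) [TopologicalSpace M] [ChartedSpace E M]
    (L : E →L[ℝ] E) : Prop :=
  ∀ (q₀ q : M), q ∈ (chartAt E q₀).source → ∀ v : E,
    chartDeriv (E := E) q₀ q (L v) = L (chartDeriv (E := E) q₀ q v)

/-- In the trivialization at `q₀` the field becomes the conjugate of `L` by a chart derivative,
which is `L` again; so its coordinate expression is locally constant. -/
theorem EndoField.isSmooth_const {L : E →L[ℝ] E} (hL : CommutesWithCharts M L) :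
    EndoField.IsSmooth (M := M) (fun _ ↦ L) := by
  intro q₀
  rw [contMDiffAt_hom_bundle]
  refine ⟨contMDiffAt_id, ?_⟩
  refine (contMDiffAt_const (c := L)).congr_of_eventuallyEq ?_
  filter_upwards [(chartAt E q₀).open_source.mem_nhds (mem_chart_source E q₀)] with q hq
  ext v
  change ((trivializationAt E (TangentSpace 𝓘(ℝ, E)) q₀).continuousLinearMapAt ℝ q)
    (L ((trivializationAt E (TangentSpace 𝓘(ℝ, E)) q₀).symmL ℝ q v)) = L v
  rw [chartDeriv_eq_continuousLinearMapAt hq]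
  exact (hL q₀ q hq _).trans (congrArg L (chartDeriv_symmL hq v))

/-- A vector field read in the chart at `q`. -/
noncomputable def chartPullback (q : M) (V : ∀ x : M, TangentSpace 𝓘(ℝ, E) x) : E → E :=
  VectorField.mpullbackWithin 𝓘(ℝ, E) 𝓘(ℝ, E) (extChartAt 𝓘(ℝ, E) q).symm V
    (Set.range 𝓘(ℝ, E))

/-- The chart at `q` has the identity as derivative at `q`, so transporting the bracket back to the
manifold changes nothing. -/
theorem mlieBracket_eq_lieBracket (V W : ∀ x : M, TangentSpace 𝓘(ℝ, E) x) (q : M) :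
    (VectorField.mlieBracket 𝓘(ℝ, E) V W q : E) =
      VectorField.lieBracket ℝ (chartPullback q V) (chartPullback q W)
        (extChartAt 𝓘(ℝ, E) q q) := by
  have h : (chartDeriv (E := E) q q).inverse = ContinuousLinearMap.id ℝ E := by
    rw [chartDeriv_self, ContinuousLinearMap.inverse_id]
  have hs : (extChartAt 𝓘(ℝ, E) q).symm ⁻¹' (Set.univ : Set M) ∩ Set.range 𝓘(ℝ, E) =
      Set.univ := by simp
  change (chartDeriv (E := E) q q).inverse
    (VectorField.lieBracketWithin ℝ (chartPullback q V) (chartPullback q W)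
      ((extChartAt 𝓘(ℝ, E) q).symm ⁻¹' (Set.univ : Set M) ∩ Set.range 𝓘(ℝ, E))
      (extChartAt 𝓘(ℝ, E) q q)) = _
  rw [h, hs, VectorField.lieBracketWithin_univ]
  rfl

theorem chartPullback_const {L : E →L[ℝ] E} (hL : CommutesWithCharts M L)
    (V : ∀ x : M, TangentSpace 𝓘(ℝ, E) x) (q : M) :
    chartPullback q (fun x ↦ L (V x)) =ᶠ[𝓝 (extChartAt 𝓘(ℝ, E) q q)]
      fun y ↦ L (chartPullback q V y) := by
  filter_upwards [extChartAt_target_mem_nhds q] with y hy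
  have h1 := mfderiv_extChartAt_comp_mfderivWithin_extChartAt_symm (I := 𝓘(ℝ, E)) hy
  have h2 := mfderivWithin_extChartAt_symm_comp_mfderiv_extChartAt (I := 𝓘(ℝ, E)) hy
  have hq : (extChartAt 𝓘(ℝ, E) q).symm y ∈ (chartAt E q).source := by
    rw [← extChartAt_source 𝓘(ℝ, E)]
    exact (extChartAt 𝓘(ℝ, E) q).map_target hy
  have key : ∀ U : ∀ x : M, TangentSpace 𝓘(ℝ, E) x, chartPullback q U y =
      chartDeriv (E := E) q ((extChartAt 𝓘(ℝ, E) q).symm y)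
        (U ((extChartAt 𝓘(ℝ, E) q).symm y)) := fun U ↦ by
    rw [chartPullback, VectorField.mpullbackWithin_apply, ContinuousLinearMap.inverse_eq h2 h1]
    rfl
  exact ((key _).trans (hL q _ hq _)).trans (congrArg L (key V)).symm

/-- In a chart the derivative of `L ∘ U` is `L ∘ DU`, and the terms of the Nijenhuis tensor cancel
in pairs, whatever `L²` is. -/
theorem EndoField.isIntegrable_const {L : E ≃L[ℝ] E}
    (hL : CommutesWithCharts M (L : E →L[ℝ] E)) :
    EndoField.IsIntegrable (M := M) (fun _ ↦ (L : E →L[ℝ] E)) := by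
  intro q V W _ _
  have hV := chartPullback_const hL V q
  have hW := chartPullback_const hL W q
  -- Invertibility of `L` makes this hold for every `U`, differentiable or not.
  have e : ∀ (U : E → E) (y : E), fderiv ℝ (fun y ↦ (L : E →L[ℝ] E) (U y)) y =
      (L : E →L[ℝ] E).comp (fderiv ℝ U y) := fun U y ↦ L.comp_fderiv (f := U)
  have key : ∀ (V W : E → E) (y : E),
      VectorField.lieBracket ℝ (fun y ↦ (L : E →L[ℝ] E) (V y)) (fun y ↦ (L : E →L[ℝ] E) (W y)) y
      - L (VectorField.lieBracket ℝ (fun y ↦ (L : E →L[ℝ] E) (V y)) W y)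
      - L (VectorField.lieBracket ℝ V (fun y ↦ (L : E →L[ℝ] E) (W y)) y)
      + L (L (VectorField.lieBracket ℝ V W y)) = 0 := by
    intro V W y
    simp only [VectorField.lieBracket, e]
    simp only [ContinuousLinearMap.comp_apply, ContinuousLinearEquiv.coe_coe, map_sub]
    abel
  have c₁ := hV.lieBracket_vectorField_eq (𝕜 := ℝ) hW
  have c₂ := hV.lieBracket_vectorField_eq (𝕜 := ℝ) (Filter.EventuallyEq.refl _ (chartPullback q W))
  have c₃ := (Filter.EventuallyEq.refl _ (chartPullback q V)).lieBracket_vectorField_eq (𝕜 := ℝ) hW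
  have b₁ := (mlieBracket_eq_lieBracket (fun x ↦ (L : E →L[ℝ] E) (V x))
    (fun x ↦ (L : E →L[ℝ] E) (W x)) q).trans c₁
  have b₂ := (mlieBracket_eq_lieBracket (fun x ↦ (L : E →L[ℝ] E) (V x)) W q).trans c₂
  have b₃ := (mlieBracket_eq_lieBracket V (fun x ↦ (L : E →L[ℝ] E) (W x)) q).trans c₃
  have b₄ := mlieBracket_eq_lieBracket V W q
  have assemble : ∀ {t₁ t₂ t₃ t₄ s₁ s₂ s₃ s₄ : E}, t₁ = s₁ → t₂ = s₂ → t₃ = s₃ → t₄ = s₄ →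
      s₁ - L s₂ - L s₃ + L (L s₄) = 0 → t₁ - L t₂ - L t₃ + L (L t₄) = 0 := by
    rintro _ _ _ _ _ _ _ _ rfl rfl rfl rfl h
    exact h
  exact assemble b₁ b₂ b₃ b₄ (key _ _ _)

end ConstantEndoField

namespace Inoue

theorem contDiff_smul_right_const {F : Type*} [NormedAddCommGroup F] [NormedSpace ℝ F] (c : F) :
    ContDiff ℝ ∞ (fun t : ℝ ↦ t • c) := contDiff_id.smul contDiff_const

/-! ### The endomorphisms `i`, `i conj`, `-conj` and the bilinear form on `ℂ × ℂ` -/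

/-- Complex conjugation of `ℂ × ℂ`. -/
noncomputable def conjMap : (ℂ × ℂ) →L[ℝ] (ℂ × ℂ) :=
  (Complex.conjCLE : ℂ →L[ℝ] ℂ).prodMap (Complex.conjCLE : ℂ →L[ℝ] ℂ)

/-- The endomorphism `J₁ = i` of `ℂ × ℂ`. -/
noncomputable def modelJ₁ : (ℂ × ℂ) →L[ℝ] (ℂ × ℂ) :=
  Complex.I • ContinuousLinearMap.id ℝ (ℂ × ℂ)

/-- The endomorphism `J₂ = i conj` of `ℂ × ℂ`. -/
noncomputable def modelJ₂ : (ℂ × ℂ) →L[ℝ] (ℂ × ℂ) := Complex.I • conjMap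

/-- The endomorphism `J₃ = -conj` of `ℂ × ℂ`. -/
noncomputable def modelJ₃ : (ℂ × ℂ) →L[ℝ] (ℂ × ℂ) := -conjMap

theorem modelJ₁_apply (v : ℂ × ℂ) : modelJ₁ v = (Complex.I * v.1, Complex.I * v.2) := rfl

theorem modelJ₂_apply (v : ℂ × ℂ) : modelJ₂ v =
    (Complex.I * (starRingEnd ℂ) v.1, Complex.I * (starRingEnd ℂ) v.2) := rfl

theorem modelJ₃_apply (v : ℂ × ℂ) : modelJ₃ v =
    (-(starRingEnd ℂ) v.1, -(starRingEnd ℂ) v.2) := rfl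

theorem modelJ₁_sq (v : ℂ × ℂ) : modelJ₁ (modelJ₁ v) = -v := by
  ext1 <;> simp [modelJ₁_apply, ← mul_assoc]

theorem modelJ₂_sq (v : ℂ × ℂ) : modelJ₂ (modelJ₂ v) = v := by
  ext1 <;> simp [modelJ₂_apply, ← mul_assoc]

theorem modelJ₃_sq (v : ℂ × ℂ) : modelJ₃ (modelJ₃ v) = v := by
  ext <;> simp [modelJ₃_apply]

theorem modelJ₁_modelJ₂ (v : ℂ × ℂ) : modelJ₁ (modelJ₂ v) = modelJ₃ v := by
  ext1 <;> simp [modelJ₁_apply, modelJ₂_apply, modelJ₃_apply, ← mul_assoc]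

theorem modelJ₂_modelJ₁ (v : ℂ × ℂ) : modelJ₂ (modelJ₁ v) = -modelJ₃ v := by
  ext1 <;> simp [modelJ₁_apply, modelJ₂_apply, modelJ₃_apply, ← mul_assoc]

theorem modelJ₁_lin (s : ℝ) (e : ℤˣ) (β : ℝ) (v : ℂ × ℂ) :
    modelJ₁ (lin s e β v) = lin s e β (modelJ₁ v) := by
  simp only [modelJ₁_apply, lin_apply]
  ext1 <;> ring

theorem modelJ₃_lin (s : ℝ) (e : ℤˣ) (β : ℝ) (v : ℂ × ℂ) :
    modelJ₃ (lin s e β v) = lin s e β (modelJ₃ v) := by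
  simp only [modelJ₃_apply, lin_apply, map_add, map_mul, Complex.conj_ofReal, map_intCast]
  ext1 <;> ring

theorem modelJ₂_lin (s : ℝ) (e : ℤˣ) (β : ℝ) (v : ℂ × ℂ) :
    modelJ₂ (lin s e β v) = lin s e β (modelJ₂ v) := by
  simp only [modelJ₂_apply, lin_apply, map_add, map_mul, Complex.conj_ofReal, map_intCast]
  ext1 <;> ring

/-- The bilinear form `(u, v) ↦ Im (u₁ conj v₂ + v₁ conj u₂)` on `ℂ × ℂ`. -/
noncomputable def modelForm : (ℂ × ℂ) →L[ℝ] (ℂ × ℂ) →L[ℝ] ℝ :=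
  (ContinuousLinearMap.compL ℝ (ℂ × ℂ) ℂ ℝ Complex.imCLM).comp
    ((ContinuousLinearMap.mul ℝ ℂ).bilinearComp (ContinuousLinearMap.fst ℝ ℂ ℂ)
        ((Complex.conjCLE : ℂ →L[ℝ] ℂ).comp (ContinuousLinearMap.snd ℝ ℂ ℂ))
      + (ContinuousLinearMap.mul ℝ ℂ).bilinearComp
        ((Complex.conjCLE : ℂ →L[ℝ] ℂ).comp (ContinuousLinearMap.snd ℝ ℂ ℂ))
        (ContinuousLinearMap.fst ℝ ℂ ℂ))

theorem modelForm_apply (u v : ℂ × ℂ) : modelForm u v =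
    u.1.im * v.2.re - u.1.re * v.2.im + (v.1.im * u.2.re - v.1.re * u.2.im) := by
  simp [modelForm]
  ring

theorem modelForm_symm (u v : ℂ × ℂ) : modelForm u v = modelForm v u := by
  rw [modelForm_apply, modelForm_apply, add_comm]

/-- The `β` terms add up to `s β (u₁ conj v₁ + v₁ conj u₁)`, which is real and has no imaginary
part. The factor `e` is the whole difference between `S^+` and `S^-`. -/
theorem modelForm_lin (s : ℝ) (e : ℤˣ) (β : ℝ) (u v : ℂ × ℂ) :
    modelForm (lin s e β u) (lin s e β v) = s * ((e : ℤ) : ℝ) * modelForm u v := by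
  simp only [modelForm_apply, lin_apply]
  rcases Int.units_eq_one_or e with rfl | rfl <;> simp <;> ring

theorem modelForm_nondegenerate {u : ℂ × ℂ} (h : ∀ v, modelForm u v = 0) : u = 0 := by
  have h1 := h (1, 0)
  have h2 := h (Complex.I, 0)
  have h3 := h (0, 1)
  have h4 := h (0, Complex.I)
  simp only [modelForm_apply] at h1 h2 h3 h4
  simp at h1 h2 h3 h4
  exact Prod.ext (Complex.ext h4 h3) (Complex.ext h2 h1)

theorem modelForm_modelJ₁ (u v : ℂ × ℂ) :
    modelForm (modelJ₁ u) (modelJ₁ v) = modelForm u v := by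
  simp only [modelForm_apply, modelJ₁_apply]
  simp
  ring

theorem modelForm_modelJ₂ (u v : ℂ × ℂ) :
    modelForm (modelJ₂ u) (modelJ₂ v) = -modelForm u v := by
  simp only [modelForm_apply, modelJ₂_apply]
  simp
  ring

theorem modelForm_modelJ₃ (u v : ℂ × ℂ) :
    modelForm (modelJ₃ u) (modelJ₃ v) = -modelForm u v := by
  simp only [modelForm_apply, modelJ₃_apply]
  simp
  ring

/-- The correction term of `θ₂` contributes a real multiple of `dz ∧ conj dz`, which is purely
imaginary and disappears in the real part. In `Ω` it contributes `dz ∧ dz = 0`. -/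
theorem Ω₁_eq (x : HC) (u v : ℂ × ℂ) :
    Ω₁ x u v = (x.1.1.im)⁻¹ * modelForm (modelJ₁ u) v := by
  simp only [Ω₁, θ₁, θ₂, modelForm_apply, modelJ₁_apply]
  simp [div_eq_mul_inv, ← Complex.ofReal_inv]
  ring

theorem re_Ω_eq (x : HC) (u v : ℂ × ℂ) :
    (Ω x u v).re = (x.1.1.im)⁻¹ * modelForm (modelJ₂ u) v := by
  simp only [Ω, θ₁, θ₂, modelForm_apply, modelJ₂_apply]
  simp [div_eq_mul_inv, ← Complex.ofReal_inv]
  ring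

theorem im_Ω_eq (x : HC) (u v : ℂ × ℂ) :
    (Ω x u v).im = (x.1.1.im)⁻¹ * modelForm (modelJ₃ u) v := by
  simp only [Ω, θ₁, θ₂, modelForm_apply, modelJ₃_apply]
  simp [div_eq_mul_inv, ← Complex.ofReal_inv]
  ring

/-- `J₁` as an equivalence. -/
noncomputable def modelE₁ : (ℂ × ℂ) ≃L[ℝ] (ℂ × ℂ) :=
  ContinuousLinearEquiv.equivOfInverse modelJ₁ (-modelJ₁)
    (fun v ↦ by simp [modelJ₁_sq]) (fun v ↦ by simp [modelJ₁_sq])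

/-- `J₂` as an equivalence. -/
noncomputable def modelE₂ : (ℂ × ℂ) ≃L[ℝ] (ℂ × ℂ) :=
  ContinuousLinearEquiv.equivOfInverse modelJ₂ modelJ₂ modelJ₂_sq modelJ₂_sq

/-- `J₃` as an equivalence. -/
noncomputable def modelE₃ : (ℂ × ℂ) ≃L[ℝ] (ℂ × ℂ) :=
  ContinuousLinearEquiv.equivOfInverse modelJ₃ modelJ₃ modelJ₃_sq modelJ₃_sq

/-! ### The para-hypercomplex structure on the surfaces and the metric on `S^+`. -/

namespace Data

variable {ε : ℤˣ} (D : Data ε)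

/-- The derivative of the projection, read in the chart at the image point. -/
noncomputable def projDeriv (x : HC) : (ℂ × ℂ) →L[ℝ] (ℂ × ℂ) :=
  mfderiv 𝓘(ℝ, ℂ × ℂ) 𝓘(ℝ, ℂ × ℂ) D.proj x

theorem exists_projDeriv (x : HC) : ∃ (s : ℝ) (k : ℤ) (β : ℝ), 0 < s ∧
    D.projDeriv x = lin s (ε ^ k) β ∧ (D.lift (D.proj x)).1.1.im = s * x.1.1.im :=
  D.exists_mfderiv_proj x

theorem exists_chartDeriv_projDeriv {q : D.Surface} {x : HC}
    (hx : D.proj x ∈ (chartAt (ℂ × ℂ) q).source) :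
    ∃ (s : ℝ) (k : ℤ) (β : ℝ), 0 < s ∧
      (∀ v, chartDeriv (E := ℂ × ℂ) q (D.proj x) (D.projDeriv x v) = lin s (ε ^ k) β v) ∧
      (chartAt (ℂ × ℂ) q (D.proj x)).1.im = s * x.1.1.im := by
  obtain ⟨s, k, β, hs, h, h'⟩ := D.exists_mfderiv_extChartAt_comp hx
  exact ⟨s, k, β, hs, fun v ↦ congrArg (fun T : (ℂ × ℂ) →L[ℝ] (ℂ × ℂ) ↦ T v) h, h'⟩

theorem surjective_projDeriv (x : HC) : Function.Surjective (D.projDeriv x) := by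
  obtain ⟨s, k, β, hs, h, -⟩ := D.exists_projDeriv x
  rw [h]
  exact LinearMap.surjective_of_injective (f := (lin s (ε ^ k) β : (ℂ × ℂ) →ₗ[ℝ] (ℂ × ℂ)))
    (lin_injective hs _ _)

theorem projDeriv_comm {L : (ℂ × ℂ) →L[ℝ] (ℂ × ℂ)}
    (hL : ∀ s e β v, L (lin s e β v) = lin s e β (L v)) (x : HC) (v : ℂ × ℂ) :
    L (D.projDeriv x v) = D.projDeriv x (L v) := by
  obtain ⟨s, k, β, -, h, -⟩ := D.exists_projDeriv x
  rw [h, hL]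

/-- Every tangent vector of the surface is the image of one on `ℍ × ℂ`. There both the projection
and its composite with a chart have derivatives of the form `lin`, with which `L` commutes. -/
theorem commutesWithCharts {L : (ℂ × ℂ) →L[ℝ] (ℂ × ℂ)}
    (hL : ∀ s e β v, L (lin s e β v) = lin s e β (L v)) :
    CommutesWithCharts D.Surface L := by
  intro q₀ q hq v
  obtain ⟨x, rfl⟩ := D.surjective_proj q
  obtain ⟨w, rfl⟩ := D.surjective_projDeriv x v
  obtain ⟨s, k, β, -, h, -⟩ := D.exists_chartDeriv_projDeriv hq
  rw [D.projDeriv_comm hL, h, h, hL]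

/-- The para-hypercomplex structure `(i, i conj, -conj)` on the surface. -/
noncomputable def paraHypercomplex : ParaHypercomplex (E := ℂ × ℂ) D.Surface where
  J₁ := fun _ ↦ modelJ₁
  J₂ := fun _ ↦ modelJ₂
  J₃ := fun _ ↦ modelJ₃
  smooth₁ := EndoField.isSmooth_const (D.commutesWithCharts modelJ₁_lin)
  smooth₂ := EndoField.isSmooth_const (D.commutesWithCharts modelJ₂_lin)
  smooth₃ := EndoField.isSmooth_const (D.commutesWithCharts modelJ₃_lin)
  sq₁ _ := modelJ₁_sq
  sq₂ _ := modelJ₂_sq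
  sq₃ _ := modelJ₃_sq
  mul₁₂ _ := modelJ₁_modelJ₂
  mul₂₁ _ := modelJ₂_modelJ₁
  integrable₁ := EndoField.isIntegrable_const (L := modelE₁) (D.commutesWithCharts modelJ₁_lin)
  integrable₂ := EndoField.isIntegrable_const (L := modelE₂) (D.commutesWithCharts modelJ₂_lin)
  integrable₃ := EndoField.isIntegrable_const (L := modelE₃) (D.commutesWithCharts modelJ₃_lin)

/-- The form `(Im z)⁻¹ Im (u₁ conj v₂ + v₁ conj u₂)` on the tangent space at `q`. -/
noncomputable def metricForm (q : D.Surface) : (ℂ × ℂ) →L[ℝ] (ℂ × ℂ) →L[ℝ] ℝ :=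
  ((D.lift q).1.1.im)⁻¹ • modelForm

theorem lift_im_pos (q : D.Surface) : 0 < (D.lift q).1.1.im := (D.lift q).2

section Plus

variable (D : Data 1)

/-- The factor `s` gained by `modelForm` cancels against the one gained by `Im z`, and the sign is a
power of `ε = 1`. -/
theorem metricForm_projDeriv (x : HC) (u v : ℂ × ℂ) :
    D.metricForm (D.proj x) (D.projDeriv x u) (D.projDeriv x v) =
      (x.1.1.im)⁻¹ * modelForm u v := by
  obtain ⟨s, k, β, hs, h, h'⟩ := D.exists_projDeriv x
  have hx : x.1.1.im ≠ 0 := ne_of_gt x.2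
  simp only [metricForm, h, h', _root_.smul_apply, modelForm_lin, smul_eq_mul]
  simp
  field_simp

theorem modelForm_chartDeriv {q₀ q : D.Surface} (hq : q ∈ (chartAt (ℂ × ℂ) q₀).source)
    (u v : ℂ × ℂ) :
    (chartAt (ℂ × ℂ) q₀ q).1.im⁻¹ *
        modelForm (chartDeriv (E := ℂ × ℂ) q₀ q u) (chartDeriv (E := ℂ × ℂ) q₀ q v) =
      D.metricForm q u v := by
  obtain ⟨x, rfl⟩ := D.surjective_proj q
  obtain ⟨u, rfl⟩ := D.surjective_projDeriv x u
  obtain ⟨v, rfl⟩ := D.surjective_projDeriv x v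
  obtain ⟨s, k, β, hs, h, h'⟩ := D.exists_chartDeriv_projDeriv hq
  have hx : x.1.1.im ≠ 0 := ne_of_gt x.2
  rw [metricForm_projDeriv, h, h, h', modelForm_lin]
  simp
  field_simp

/-- `D.lift` is a mere choice of preimages and need not be continuous. In the trivialization at
`q₀`, however, `modelForm_chartDeriv` replaces the height of `D.lift q` by that of the fixed chart
at `q₀`, leaving the smooth coefficient `(Im z)⁻¹`. -/
theorem contMDiff_metricForm :
    ContMDiff 𝓘(ℝ, ℂ × ℂ) (𝓘(ℝ, ℂ × ℂ).prod 𝓘(ℝ, (ℂ × ℂ) →L[ℝ] (ℂ × ℂ) →L[ℝ] ℝ)) ∞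
      (fun x ↦ Bundle.TotalSpace.mk' ((ℂ × ℂ) →L[ℝ] (ℂ × ℂ) →L[ℝ] ℝ)
        (E := fun x : D.Surface ↦
          TangentSpace 𝓘(ℝ, ℂ × ℂ) x →L[ℝ] TangentSpace 𝓘(ℝ, ℂ × ℂ) x →L[ℝ] ℝ)
        x (D.metricForm x)) := by
  intro q₀
  rw [contMDiffAt_hom_bundle]
  refine ⟨contMDiffAt_id, ?_⟩
  have hc : ContMDiffAt 𝓘(ℝ, ℂ × ℂ) 𝓘(ℝ, ℂ × ℂ) ∞ (chartAt (ℂ × ℂ) q₀) q₀ :=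
    contMDiffAt_of_mem_maximalAtlas (IsManifold.chart_mem_maximalAtlas q₀) (mem_chart_source _ q₀)
  have him : ContDiff ℝ ∞ (fun p : ℂ × ℂ ↦ p.1.im) :=
    Complex.imCLM.contDiff.comp contDiff_fst
  have h0 : (chartAt (ℂ × ℂ) q₀ q₀).1.im ≠ 0 := by
    rw [chartAt_self]
    exact (D.lift_im_pos q₀).ne'
  have hS : ContDiff ℝ ∞ (fun t : ℝ ↦ t • modelForm) :=
    contDiff_smul_right_const modelForm
  have hG : ContDiffAt ℝ ∞ (fun p : ℂ × ℂ ↦ p.1.im⁻¹ • modelForm) (chartAt (ℂ × ℂ) q₀ q₀) :=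
    hS.contDiffAt.comp _ (him.contDiffAt.inv h0)
  refine (hG.contMDiffAt.comp q₀ hc).congr_of_eventuallyEq ?_
  filter_upwards [(chartAt (ℂ × ℂ) q₀).open_source.mem_nhds (mem_chart_source (ℂ × ℂ) q₀)]
    with q hq
  refine ContinuousLinearMap.ext fun u ↦ ContinuousLinearMap.ext fun v ↦ ?_
  refine (inCoordinates_apply_eq₂ (E₃ := Bundle.Trivial D.Surface ℝ) hq hq
    (Set.mem_univ _)).trans ?_
  have := D.modelForm_chartDeriv hq
    ((trivializationAt (ℂ × ℂ) (TangentSpace 𝓘(ℝ, ℂ × ℂ)) q₀).symmL ℝ q u)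
    ((trivializationAt (ℂ × ℂ) (TangentSpace 𝓘(ℝ, ℂ × ℂ)) q₀).symmL ℝ q v)
  rw [chartDeriv_symmL hq, chartDeriv_symmL hq] at this
  refine Eq.trans ?_ this.symm
  simp only [Bundle.Trivial.fiberBundle_trivializationAt', Bundle.Trivial.linearMapAt_trivialization,
    LinearMap.id_apply]
  exact congrArg₂ (fun a b : ℂ × ℂ ↦ D.metricForm q a b)
    (Bundle.Trivialization.symmL_apply _ hq u).symm
    (Bundle.Trivialization.symmL_apply _ hq v).symm

/-- The metric `(Im z)⁻¹ Im (u₁ conj v₂ + v₁ conj u₂)` on a surface of type `S^+`. -/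
noncomputable def metric : PseudoRiemannianMetric (E := ℂ × ℂ) D.Surface where
  form := D.metricForm
  smooth := D.contMDiff_metricForm
  symm q v w := congrArg (fun t : ℝ ↦ (D.lift q).1.1.im⁻¹ * t) (modelForm_symm v w)
  nondegenerate q _ h := modelForm_nondegenerate fun w ↦
    (mul_eq_zero.1 (h w)).resolve_left (inv_ne_zero (D.lift_im_pos q).ne')

theorem metric_isCompatible : D.metric.IsCompatible D.paraHypercomplex := fun q v w ↦
  ⟨congrArg (fun t : ℝ ↦ (D.lift q).1.1.im⁻¹ * t) (modelForm_modelJ₁ v w),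
    (congrArg (fun t : ℝ ↦ (D.lift q).1.1.im⁻¹ * t) (modelForm_modelJ₂ v w)).trans (mul_neg _ _),
    (congrArg (fun t : ℝ ↦ (D.lift q).1.1.im⁻¹ * t) (modelForm_modelJ₃ v w)).trans (mul_neg _ _)⟩

theorem metricForm_comm_projDeriv {L : (ℂ × ℂ) →L[ℝ] (ℂ × ℂ)}
    (hL : ∀ s e β v, L (lin s e β v) = lin s e β (L v)) (x : HC) (u v : ℂ × ℂ) :
    D.metricForm (D.proj x) (L (D.projDeriv x u)) (D.projDeriv x v) =
      (x.1.1.im)⁻¹ * modelForm (L u) v := by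
  rw [D.projDeriv_comm hL, metricForm_projDeriv]

end Plus

end Data

/-! ### Derivatives of `κ` and `σ`, and the anti-isometry. -/

theorem hasMFDerivAt_aff (s : ℝ) (hs : 0 < s) (e : ℤˣ) (u β δ : ℝ) (x : HC) :
    HasMFDerivAt 𝓘(ℝ, ℂ × ℂ) 𝓘(ℝ, ℂ × ℂ) (aff s hs e u β δ) x (lin s e β) := by
  have h := ((contMDiff_aff ℝ 1 s hs e u β δ).mdifferentiableAt one_ne_zero (x := x)).hasMFDerivAt
  have h1 := (hasMFDerivAt_val (aff s hs e u β δ x)).comp x h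
  have h2 := hasMFDerivAt_unique h1 (hasMFDerivAt_affMap_val s e u β δ x)
  have h3 : mfderiv 𝓘(ℝ, ℂ × ℂ) 𝓘(ℝ, ℂ × ℂ) (aff s hs e u β δ) x = lin s e β := h2
  rwa [h3] at h

namespace Data

variable (D : Data (-1))

theorem mfderiv_κ (x : HC) (v : ℂ × ℂ) :
    mfderiv 𝓘(ℝ, ℂ × ℂ) 𝓘(ℝ, ℂ × ℂ) D.κ (D.double.proj x) (D.double.projDeriv x v) =
      D.projDeriv x v := by
  have h : MDifferentiableAt 𝓘(ℝ, ℂ × ℂ) 𝓘(ℝ, ℂ × ℂ) D.κ (D.double.proj x) :=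
    (D.isLocalDiffeomorph_κ ℝ 1).contMDiff.mdifferentiableAt one_ne_zero
  have h1 := h.hasMFDerivAt.comp x (D.double.mdifferentiableAt_proj x).hasMFDerivAt
  have h2 := hasMFDerivAt_unique h1 (D.mdifferentiableAt_proj x).hasMFDerivAt
  exact congrArg (fun T : (ℂ × ℂ) →L[ℝ] (ℂ × ℂ) ↦ T v) h2

theorem mfderiv_σ (x : HC) (v : ℂ × ℂ) :
    mfderiv 𝓘(ℝ, ℂ × ℂ) 𝓘(ℝ, ℂ × ℂ) D.σ (D.double.proj x) (D.double.projDeriv x v) =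
      D.double.projDeriv (D.φ₀ x) (lin D.α (-1) 0 v) := by
  have h : MDifferentiableAt 𝓘(ℝ, ℂ × ℂ) 𝓘(ℝ, ℂ × ℂ) D.σ (D.double.proj x) :=
    (D.contMDiff_σ ℝ 1).mdifferentiableAt one_ne_zero
  have h1 := h.hasMFDerivAt.comp x (D.double.mdifferentiableAt_proj x).hasMFDerivAt
  have h2 := hasMFDerivAt_unique h1 ((D.double.mdifferentiableAt_proj (D.φ₀ x)).hasMFDerivAt.comp x
    (hasMFDerivAt_aff D.α D.α_pos (-1) 0 0 0 x))
  exact congrArg (fun T : (ℂ × ℂ) →L[ℝ] (ℂ × ℂ) ↦ T v) h2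

/-- Chain rule for `D.proj ∘ D.φ₀ = D.proj`. It makes anything pulled back from `S^-` invariant
under `φ₀`. -/
theorem projDeriv_φ₀ (x : HC) (v : ℂ × ℂ) :
    D.projDeriv (D.φ₀ x) (lin D.α (-1) 0 v) = D.projDeriv x v := by
  have h : D.proj ∘ D.φ₀ = D.proj :=
    funext fun y ↦ D.proj_eq_iff.2 ⟨_, D.φ₀_mem, rfl⟩
  have h1 := (D.mdifferentiableAt_proj (D.φ₀ x)).hasMFDerivAt.comp x
    (hasMFDerivAt_aff D.α D.α_pos (-1) 0 0 0 x)
  have h2 : HasMFDerivAt 𝓘(ℝ, ℂ × ℂ) 𝓘(ℝ, ℂ × ℂ) (D.proj ∘ D.φ₀) x (D.projDeriv x) := by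
    rw [h]
    exact (D.mdifferentiableAt_proj x).hasMFDerivAt
  exact congrArg (fun T : (ℂ × ℂ) →L[ℝ] (ℂ × ℂ) ↦ T v) (hasMFDerivAt_unique h1 h2)

theorem related_κ {L : (ℂ × ℂ) →L[ℝ] (ℂ × ℂ)}
    (hL : ∀ s e β v, L (lin s e β v) = lin s e β (L v)) :
    Related D.κ (fun _ ↦ L) (fun _ ↦ L) := by
  intro m v
  obtain ⟨x, rfl⟩ := D.double.surjective_proj m
  obtain ⟨w, rfl⟩ := D.double.surjective_projDeriv x v
  have e : L (D.double.projDeriv x w) = D.double.projDeriv x (L w) := D.double.projDeriv_comm hL x w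
  refine (congrArg L (D.mfderiv_κ x w)).trans ?_
  refine (D.projDeriv_comm hL x w).trans ?_
  refine (D.mfderiv_κ x (L w)).symm.trans ?_
  exact congrArg (fun t : ℂ × ℂ ↦
    mfderiv 𝓘(ℝ, ℂ × ℂ) 𝓘(ℝ, ℂ × ℂ) D.κ (D.double.proj x) t) e.symm

theorem φ₀_im (x : HC) : (D.φ₀ x).1.1.im = D.α * x.1.1.im := by
  rw [φ₀, aff_val]
  simp

/-- The lift `φ₀` of `σ` multiplies `modelForm` by `-α` and `Im z` by `α`. -/
theorem metric_σ (m : D.double.Surface) (u v : TangentSpace 𝓘(ℝ, ℂ × ℂ) m) :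
    D.double.metric.form (D.σ m) (mfderiv 𝓘(ℝ, ℂ × ℂ) 𝓘(ℝ, ℂ × ℂ) D.σ m u)
      (mfderiv 𝓘(ℝ, ℂ × ℂ) 𝓘(ℝ, ℂ × ℂ) D.σ m v) = -D.double.metric.form m u v := by
  obtain ⟨x, rfl⟩ := D.double.surjective_proj m
  obtain ⟨u, rfl⟩ := D.double.surjective_projDeriv x u
  obtain ⟨v, rfl⟩ := D.double.surjective_projDeriv x v
  have h : D.double.metricForm (D.double.proj (D.φ₀ x))
      (D.double.projDeriv (D.φ₀ x) (lin D.α (-1) 0 u))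
      (D.double.projDeriv (D.φ₀ x) (lin D.α (-1) 0 v)) =
      -D.double.metricForm (D.double.proj x) (D.double.projDeriv x u) (D.double.projDeriv x v) := by
    have hα := D.α_pos.ne'
    have hx : x.1.1.im ≠ 0 := ne_of_gt x.2
    rw [metricForm_projDeriv, metricForm_projDeriv, modelForm_lin, φ₀_im]
    simp
    field_simp
  exact (congrArg₂ (fun a b : ℂ × ℂ ↦ D.double.metricForm (D.double.proj (D.φ₀ x)) a b)
    (D.mfderiv_σ x u) (D.mfderiv_σ x v)).trans h

end Data

/-! ### Non-existence of a compatible metric on `S^-` -/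

instance : PreconnectedSpace HC := by
  have : Convex ℝ (HC : Set (ℂ × ℂ)) := by
    have h : (HC : Set (ℂ × ℂ)) = (Complex.imLm ∘ₗ LinearMap.fst ℝ ℂ ℂ) ⁻¹' Set.Ioi 0 := rfl
    rw [h]
    exact (convex_Ioi 0).linear_preimage _
  exact Subtype.preconnectedSpace this.isPreconnected

/-- A nonzero form compatible with `(i, i conj, -conj)` pairs `(1, 0)` and `(0, i)` nontrivially. -/
theorem form_ne_zero_of_compatible (B : (ℂ × ℂ) →L[ℝ] (ℂ × ℂ) →L[ℝ] ℝ)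
    (symm : ∀ u v, B u v = B v u) (nondeg : ∀ u, (∀ v, B u v = 0) → u = 0)
    (h₁ : ∀ u v, B (modelJ₁ u) (modelJ₁ v) = B u v)
    (h₃ : ∀ u v, B (modelJ₃ u) (modelJ₃ v) = -B u v) :
    B (1, 0) (0, Complex.I) ≠ 0 := by
  intro h0
  have a1 : modelJ₃ (1, 0) = -(1, 0) := by simp [modelJ₃_apply]
  have a2 : modelJ₃ (0, 1) = -(0, 1) := by simp [modelJ₃_apply]
  have a3 : modelJ₁ (1, 0) = (Complex.I, 0) := by simp [modelJ₁_apply]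
  have a4 : modelJ₁ (Complex.I, 0) = -(1, 0) := by simp [modelJ₁_apply]
  -- `J₃` is `-1` on real vectors, hence preserves `B` there; by compatibility it also negates `B`.
  -- Real vectors are thus isotropic and mutually orthogonal.
  have b1 : B (1, 0) (1, 0) = 0 := by
    have := h₃ (1, 0) (1, 0)
    rw [a1, map_neg, map_neg, neg_apply] at this
    linarith
  have b2 : B (1, 0) (0, 1) = 0 := by
    have := h₃ (1, 0) (0, 1)
    rw [a1, a2, map_neg, map_neg, neg_apply] at this
    linarith
  -- `J₁` turns the pair `(u, J₁ u)` into `(J₁ u, -u)`, so symmetry gives `B u (J₁ u) = -B u (J₁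
  -- u)`. With `h0`, the vector `(1, 0)` is then orthogonal to a real basis.
  have b3 : B (1, 0) (Complex.I, 0) = 0 := by
    have := h₁ (1, 0) (Complex.I, 0)
    rw [a3, a4, map_neg, symm] at this
    linarith
  have : ((1, 0) : ℂ × ℂ) = 0 := by
    refine nondeg _ fun v ↦ ?_
    have hv : v = v.1.re • ((1, 0) : ℂ × ℂ) + v.1.im • ((Complex.I, 0) : ℂ × ℂ)
        + v.2.re • ((0, 1) : ℂ × ℂ) + v.2.im • ((0, Complex.I) : ℂ × ℂ) := by
      ext <;> simp
    rw [hv]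
    simp only [map_add, map_smul, b1, b2, b3, h0, smul_zero, add_zero]
  simp at this

theorem continuous_const_section (u : ℂ × ℂ) : Continuous fun x : HC ↦
    (Bundle.TotalSpace.mk' (ℂ × ℂ) x u : TangentBundle 𝓘(ℝ, ℂ × ℂ) HC) := by
  rw [continuous_iff_continuousAt]
  intro x₀
  rw [FiberBundle.continuousAt_totalSpace]
  refine ⟨continuousAt_id, (continuousAt_const (y := u)).congr (Filter.Eventually.of_forall ?_)⟩
  intro x
  have h : (mfderiv 𝓘(ℝ, ℂ × ℂ) 𝓘(ℝ, ℂ × ℂ) (extChartAt 𝓘(ℝ, ℂ × ℂ) x₀) x) =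
      ContinuousLinearMap.id ℝ (ℂ × ℂ) := (hasMFDerivAt_val x).mfderiv
  have hx : x ∈ (chartAt (ℂ × ℂ) x₀).source := by
    rw [TopologicalSpace.Opens.chartAt_eq, OpenPartialHomeomorph.subtypeRestr_source]
    exact Set.mem_univ _
  have h' := (TangentBundle.continuousLinearMapAt_trivializationAt (I := 𝓘(ℝ, ℂ × ℂ)) hx).trans h
  refine Eq.trans ?_
    (Bundle.Trivialization.continuousLinearMapAt_apply_of_mem (R := ℝ)
      (trivializationAt (ℂ × ℂ) (TangentSpace 𝓘(ℝ, ℂ × ℂ)) x₀) hx u)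
  exact (congrArg (fun T : (ℂ × ℂ) →L[ℝ] (ℂ × ℂ) ↦ T u) h').symm

namespace Data

variable {ε : ℤˣ} (D : Data ε)

/-- `D.projDeriv x` is expressed in the chart centred at `D.proj x`, which may jump with `x`.
Continuity is therefore proved in the bundles: constant sections are pushed forward by the tangent
map and then paired with `h`. -/
theorem continuous_form_projDeriv (h : PseudoRiemannianMetric (E := ℂ × ℂ) D.Surface)
    (u v : ℂ × ℂ) : Continuous fun x : HC ↦
      (h.form (D.proj x) : (ℂ × ℂ) →L[ℝ] (ℂ × ℂ) →L[ℝ] ℝ)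
        (D.projDeriv x u) (D.projDeriv x v) := by
  have hT : ∀ u : ℂ × ℂ, Continuous fun x : HC ↦
      Bundle.TotalSpace.mk' (ℂ × ℂ) (E := TangentSpace 𝓘(ℝ, ℂ × ℂ)) (D.proj x)
        (D.projDeriv x u) := fun u ↦
    ((D.contMDiff_proj ℝ ∞).continuous_tangentMap (by simp)).comp (continuous_const_section u)
  have := h.smooth.continuous.comp D.isLocalHomeomorph_proj.continuous
  have key := Continuous.clm_bundle_apply₂ (E₃ := Bundle.Trivial D.Surface ℝ) this (hT u) (hT v)
  exact continuous_snd.comp ((Bundle.Trivial.homeomorphProd D.Surface ℝ).continuous.comp key)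

/-- The pulled-back metric, evaluated on `(1, 0)` and `(0, i)`, is a continuous nowhere vanishing
function `f` on a connected space. Invariance under `φ₀`, whose derivative sends these vectors to `α
(1, 0)` and `-(0, i)`, gives `f = -α (f ∘ φ₀)`, so `f` takes both signs. -/
theorem not_exists_compatible (D : Data (-1)) :
    ¬ ∃ h : PseudoRiemannianMetric (E := ℂ × ℂ) D.Surface, h.IsCompatible D.paraHypercomplex := by
  rintro ⟨h, hc⟩
  let B : HC → (ℂ × ℂ) →L[ℝ] (ℂ × ℂ) →L[ℝ] ℝ := fun x ↦
    (h.form (D.proj x) : (ℂ × ℂ) →L[ℝ] (ℂ × ℂ) →L[ℝ] ℝ).bilinearComp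
      (D.projDeriv x) (D.projDeriv x)
  have hinj : ∀ x, Function.Injective (D.projDeriv x) := fun x ↦ by
    obtain ⟨s, k, β, hs, e, -⟩ := D.exists_projDeriv x
    rw [e]
    exact lin_injective hs _ _
  have hne : ∀ x, B x (1, 0) (0, Complex.I) ≠ 0 := fun x ↦ by
    apply form_ne_zero_of_compatible
    · exact fun u v ↦ h.symm _ _ _
    · intro u hu
      apply hinj x
      rw [map_zero]
      apply h.nondegenerate (D.proj x)
      intro w
      obtain ⟨w, rfl⟩ := D.surjective_projDeriv x w
      exact hu w
    · intro u v
      refine Eq.trans ?_ (hc (D.proj x) (D.projDeriv x u) (D.projDeriv x v)).1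
      exact (congrArg₂ (fun a b : ℂ × ℂ ↦ (h.form (D.proj x) : (ℂ × ℂ) →L[ℝ] (ℂ × ℂ) →L[ℝ] ℝ) a b)
        (D.projDeriv_comm modelJ₁_lin x u) (D.projDeriv_comm modelJ₁_lin x v)).symm
    · intro u v
      refine Eq.trans ?_ (hc (D.proj x) (D.projDeriv x u) (D.projDeriv x v)).2.2
      exact (congrArg₂ (fun a b : ℂ × ℂ ↦ (h.form (D.proj x) : (ℂ × ℂ) →L[ℝ] (ℂ × ℂ) →L[ℝ] ℝ) a b)
        (D.projDeriv_comm modelJ₃_lin x u) (D.projDeriv_comm modelJ₃_lin x v)).symm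
  have hφ : ∀ x u v, B (D.φ₀ x) (lin D.α (-1) 0 u) (lin D.α (-1) 0 v) = B x u v := by
    intro x u v
    have hp : D.proj (D.φ₀ x) = D.proj x := D.proj_eq_iff.2 ⟨_, D.φ₀_mem, rfl⟩
    change (h.form (D.proj (D.φ₀ x)) : (ℂ × ℂ) →L[ℝ] (ℂ × ℂ) →L[ℝ] ℝ)
      (D.projDeriv (D.φ₀ x) (lin D.α (-1) 0 u)) (D.projDeriv (D.φ₀ x) (lin D.α (-1) 0 v)) =
      (h.form (D.proj x) : (ℂ × ℂ) →L[ℝ] (ℂ × ℂ) →L[ℝ] ℝ) (D.projDeriv x u) (D.projDeriv x v)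
    rw [projDeriv_φ₀, projDeriv_φ₀, hp]
  have hcont : Continuous fun x ↦ B x (1, 0) (0, Complex.I) :=
    D.continuous_form_projDeriv h (1, 0) (0, Complex.I)
  let x : HC := ⟨(Complex.I, 0), by change 0 < Complex.I.im; simp⟩
  have hsign : B x (1, 0) (0, Complex.I) = -(D.α * B (D.φ₀ x) (1, 0) (0, Complex.I)) := by
    have e1 : lin D.α (-1) 0 (1, 0) = D.α • (1, 0) := by
      simp [lin_apply]
    have e2 : lin D.α (-1) 0 (0, Complex.I) = -(0, Complex.I) := by
      simp [lin_apply]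
    rw [← hφ x, e1, e2, map_neg, map_smul, smul_apply, smul_eq_mul]
  -- Intermediate value theorem between `x` and `φ₀ x`, where the values have opposite signs since
  -- `α > 0`.
  have hz : (0 : ℝ) ∈ Set.range fun x ↦ B x (1, 0) (0, Complex.I) := by
    have hconn := isPreconnected_range hcont
    have hα := D.α_pos
    rcases lt_or_gt_of_ne (hne x) with hx | hx
    · refine hconn.Icc_subset ⟨x, rfl⟩ ⟨D.φ₀ x, rfl⟩ ⟨hx.le, ?_⟩
      rw [hsign] at hx
      by_contra hn
      nlinarith
    · refine hconn.Icc_subset ⟨D.φ₀ x, rfl⟩ ⟨x, rfl⟩ ⟨?_, hx.le⟩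
      rw [hsign] at hx
      by_contra hn
      nlinarith
  obtain ⟨y, hy⟩ := hz
  exact hne y hy

end Data

end Inoue

/-! ### The theorem, with the doubled data as `S^+`. -/

theorem mainTheorem1 (D : Inoue.Data (-1)) :
    ∃ (D' : Inoue.Data 1) (κ : D'.Surface → D.Surface) (σ : D'.Surface → D'.Surface)
      (g : PseudoRiemannianMetric (E := ℂ × ℂ) D'.Surface)
      (P : ParaHypercomplex (E := ℂ × ℂ) D'.Surface)
      (Q : ParaHypercomplex (E := ℂ × ℂ) D.Surface),
      -- the surface `S^+` (with `t = 0`) belonging to `N²`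
      (D'.N = D.N ^ 2 ∧ D'.α = D.α ^ 2 ∧ D'.a = D.a ∧ D'.b = D.b ∧ D'.c = D.c ∧ D'.r = D.r) ∧
      -- is a double covering of `S^-`, induced by the identity of `ℍ × ℂ`,
      (∀ x, κ (D'.proj x) = D.proj x) ∧
      IsLocalDiffeomorph 𝓘(ℂ, ℂ × ℂ) 𝓘(ℂ, ℂ × ℂ) ω κ ∧ IsCoveringMap κ ∧
      -- and `S^-` is its quotient by the fixed point free holomorphic involution `σ` that is
      -- induced by `(z, w) ↦ (α z, -w)`
      (∀ x, σ (D'.proj x) = D'.proj (D.φ₀ x)) ∧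
      ContMDiff 𝓘(ℂ, ℂ × ℂ) 𝓘(ℂ, ℂ × ℂ) ω σ ∧
      (∀ m, σ (σ m) = m) ∧ (∀ m, σ m ≠ m) ∧ (∀ m m', κ m = κ m' ↔ m' = m ∨ m' = σ m) ∧
      -- `(g, P)` is the para-hyperhermitian structure on `S^+` defined by `(Ω₁, Re Ω, Im Ω)`
      g.IsCompatible P ∧ P.J₁ = Inoue.complexStructure D'.Surface ∧
      (∀ (x : Inoue.HC) (u v : TangentSpace 𝓘(ℝ, ℂ × ℂ) x),
        g.form (D'.proj x)
            (P.J₁ (D'.proj x) (mfderiv 𝓘(ℝ, ℂ × ℂ) 𝓘(ℝ, ℂ × ℂ) D'.proj x u))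
            (mfderiv 𝓘(ℝ, ℂ × ℂ) 𝓘(ℝ, ℂ × ℂ) D'.proj x v) = Inoue.Ω₁ x u v ∧
        g.form (D'.proj x)
            (P.J₂ (D'.proj x) (mfderiv 𝓘(ℝ, ℂ × ℂ) 𝓘(ℝ, ℂ × ℂ) D'.proj x u))
            (mfderiv 𝓘(ℝ, ℂ × ℂ) 𝓘(ℝ, ℂ × ℂ) D'.proj x v) = (Inoue.Ω x u v).re ∧
        g.form (D'.proj x)
            (P.J₃ (D'.proj x) (mfderiv 𝓘(ℝ, ℂ × ℂ) 𝓘(ℝ, ℂ × ℂ) D'.proj x u))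
            (mfderiv 𝓘(ℝ, ℂ × ℂ) 𝓘(ℝ, ℂ × ℂ) D'.proj x v) = (Inoue.Ω x u v).im) ∧
      -- `σ` is an anti-isometry of `g`
      (∀ (m : D'.Surface) (u v : TangentSpace 𝓘(ℝ, ℂ × ℂ) m),
        g.form (σ m) (mfderiv 𝓘(ℝ, ℂ × ℂ) 𝓘(ℝ, ℂ × ℂ) σ m u)
          (mfderiv 𝓘(ℝ, ℂ × ℂ) 𝓘(ℝ, ℂ × ℂ) σ m v) = -g.form m u v) ∧
      -- the para-hypercomplex structure `P` descends to the structure `Q` on the complex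
      -- surface `S^-`
      Inoue.Related κ P.J₁ Q.J₁ ∧ Inoue.Related κ P.J₂ Q.J₂ ∧ Inoue.Related κ P.J₃ Q.J₃ ∧
      Q.J₁ = Inoue.complexStructure D.Surface ∧
      -- which admits no compatible metric
      ¬ ∃ h : PseudoRiemannianMetric (E := ℂ × ℂ) D.Surface, h.IsCompatible Q := by
  refine ⟨D.double, D.κ, D.σ, D.double.metric, D.double.paraHypercomplex, D.paraHypercomplex,
    ⟨rfl, rfl, rfl, rfl, rfl, rfl⟩, D.κ_proj, D.isLocalDiffeomorph_κ ℂ ω, D.isCoveringMap_κ,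
    D.σ_proj, D.contMDiff_σ ℂ ω, D.σ_σ, D.σ_ne, D.κ_eq_κ_iff, D.double.metric_isCompatible, rfl,
    fun x u v ↦ ⟨?_, ?_, ?_⟩, D.metric_σ, D.related_κ Inoue.modelJ₁_lin,
    D.related_κ Inoue.modelJ₂_lin, D.related_κ Inoue.modelJ₃_lin, rfl, D.not_exists_compatible⟩
  · exact (D.double.metricForm_comm_projDeriv Inoue.modelJ₁_lin x u v).trans
      (Inoue.Ω₁_eq x u v).symm
  · exact (D.double.metricForm_comm_projDeriv Inoue.modelJ₂_lin x u v).trans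
      (Inoue.re_Ω_eq x u v).symm
  · exact (D.double.metricForm_comm_projDeriv Inoue.modelJ₃_lin x u v).trans
      (Inoue.im_Ω_eq x u v).symm
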